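/- Setting. Let $d\ge 1$, $m\ge 0$, let $g:\mathbb R^d\times\mathbb R^m\to\mathbb R$ be measurable, and let $X$ (values in $\mathbb R^d$) and $\epsilon$ (values in $\mathbb R^m$, the random seed) be independent random vectors, $Y=g(X,\epsilon)$. For $x\in\mathbb R^d$ let $Y^x=g(x,\epsilon)$, and for a ball $B$ centred at $x$ with radius $r_B>0$ let $Y^B$ have the law of $Y$ given $X\in B$. $F_Z$ denotes the distribution function of $Z$. Fix $\alpha\in[1/2,1)$ and let $\theta^*(x)=\inf\{t: F_{Y^x}(t)\ge\alpha\}$. Assume: - (A1) for every $x\in\operatorname{supp}(X)$ there is a constant $M(x)$ with $|F_{Y^B}(t)-F_{Y^x}(t)|\le M(x)\,r_B$ for all $t\in\mathbb R$ and all balls $B$ centred at $x$; - (A2) the law of $X$ has a density which is bounded below by a constant $C_{input}>0$ on $\operatorname{supp}(X)$; - (A3) there is a compact interval $[L_Y,U_Y]$ such that $g(x,\epsilon)\in[L_Y,U_Y]$ almost surely for every $x\in\operatorname{supp}(X)$; - (A4) for every $x\in\operatorname{supp}(X)$ the law of $g(x,\epsilon)$ has a density which is bounded below by a constant $C_g(x)>0$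 on its support. Let $x\in\operatorname{supp}(X)$ be a point at which $\operatorname{supp}(X)$ has positive lower Lebesgue density (there are $c,r_0>0$ with $\lambda(\operatorname{supp}(X)\cap B(x,r))\ge c\,\lambda(B(x,r))$ for $0<r\le r_0$; this holds at every interior point and at Lebesgue-almost every point of $\operatorname{supp}(X)$), and such that the support of the law of $g(x,\epsilon)$ is an interval. Algorithm. Let $(X_i,\epsilon_i)_{i\ge1}$ be i.i.d. copies of $(X,\epsilon)$, $Y_i=g(X_i,\epsilon_i)$, $\gamma_n=n^{-\gamma}$, $k_n=\lfloor n^\beta\rfloor$, $\theta_0(x)\in\mathbb R$ and $$\theta_{n+1}(x)=\theta_n(x)-\gamma_{n+1}\big(\mathbf 1_{Y_{n+1}\le\theta_n(x)}-\alpha\big)\mathbf 1_{\|X_{n+1}-x\|\le\|X-x\|_{(k_{n+1},n)}},$$ where $\|X-x\|_{(k,n)}$ is the $k$-th smallest of $\|X_1-x\|,\dots,\|X_n-x\|$ (and $+\infty$ if $n<k$, which only occurs for $n=0$). Let $a_n(x)=\mathbb E\big[(\theta_n(x)-\theta^*(x))^2\big]$. Claim. Let $0<\gamma\le\beta<1$,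 $1-\beta<\varepsilon<1$ and $R\in\mathbb R$. There are a rank $N_4$ and constants $C_7,C_8>0$, depending only on the model (that is, on $g$ and the law of $(X,\epsilon)$), $x$, $\alpha$, $d$, $\gamma$, $\beta$, $\varepsilon$ and $R$, such that for every starting value with $|\theta_0(x)|\le R$ and every $n\ge N_4$ the expectation $a_n(x)$ is finite and - if $\beta>1-d\gamma$ and $1-\beta<\varepsilon<\min\big(1-\gamma,(1+\tfrac1d)(1-\beta)\big)$, then $$a_n(x)\le\frac{C_7}{n^{-\varepsilon+(1+\frac1d)(1-\beta)}};$$ - if $\beta\le1-d\gamma$ and $1-\beta<\varepsilon<\min(1-\beta+\gamma,1-\gamma)$, then $$a_n(x)\le\frac{C_8}{n^{\gamma-\beta+1-\varepsilon}}.$$ -/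

import Mathlib

open MeasureTheory ProbabilityTheory Finset
open scoped ENNReal

noncomputable section

namespace StochasticCode

variable {d m : ℕ}

/-- The law of `g(x, ε)`, i.e. of the output `Y^x` of the code at the input `x`, when the random
seed `ε` has law `ν`. -/
def codeLaw (g : EuclideanSpace ℝ (Fin d) → EuclideanSpace ℝ (Fin m) → ℝ)
    (ν : Measure (EuclideanSpace ℝ (Fin m))) (x : EuclideanSpace ℝ (Fin d)) : Measure ℝ :=
  ν.map (g x)

/-- The law of `Y^B`, i.e. the conditional law of `Y = g(X, ε)` given `X ∈ B`, where `B` is the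
closed ball with centre `x` and radius `r`, and `X ∼ μ` and `ε ∼ ν` are independent. -/
def condCodeLaw (g : EuclideanSpace ℝ (Fin d) → EuclideanSpace ℝ (Fin m) → ℝ)
    (μ : Measure (EuclideanSpace ℝ (Fin d))) (ν : Measure (EuclideanSpace ℝ (Fin m)))
    (x : EuclideanSpace ℝ (Fin d)) (r : ℝ) : Measure ℝ :=
  (ProbabilityTheory.cond (μ.prod ν) {p | p.1 ∈ Metric.closedBall x r}).map
    (fun p => g p.1 p.2)

/-- The quantile of level `α` of a law on `ℝ`: the generalized inverse at `α` of its cumulative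
distribution function. -/
def quantile (ρ : Measure ℝ) (α : ℝ) : ℝ := sInf {t : ℝ | α ≤ cdf ρ t}

/-- The law `ρ` has a (Lebesgue) density which is bounded below by `c` on the support of `ρ`. -/
def HasDensityBoundedBelow {E : Type*} [TopologicalSpace E] [MeasureSpace E]
    (ρ : Measure E) (c : ℝ) : Prop :=
  ∃ f : E → ℝ≥0∞, Measurable f ∧ ρ = volume.withDensity f ∧
    ∀ z ∈ ρ.support, ENNReal.ofReal c ≤ f z

/-- Assumption A1: for every `x` in the support of `X` there is `M(x)` with
`|F_{Y^B}(t) - F_{Y^x}(t)| ≤ M(x) r_B` for all balls `B` centred at `x` and all `t`. -/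
def AssumptionA1 (g : EuclideanSpace ℝ (Fin d) → EuclideanSpace ℝ (Fin m) → ℝ)
    (μ : Measure (EuclideanSpace ℝ (Fin d))) (ν : Measure (EuclideanSpace ℝ (Fin m))) : Prop :=
  ∀ x ∈ μ.support, ∃ M : ℝ, ∀ r : ℝ, 0 < r → ∀ t : ℝ,
    |cdf (condCodeLaw g μ ν x r) t - cdf (codeLaw g ν x) t| ≤ M * r

/-- Assumption A2: `X` has a density, bounded below by a positive constant on the support. -/
def AssumptionA2 (μ : Measure (EuclideanSpace ℝ (Fin d))) : Prop :=
  ∃ C : ℝ, 0 < C ∧ HasDensityBoundedBelow μ C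

/-- Assumption A3: the code takes its values in the compact interval `[L, U]`, for inputs in the
support of `X` and almost every value of the seed. -/
def AssumptionA3 (g : EuclideanSpace ℝ (Fin d) → EuclideanSpace ℝ (Fin m) → ℝ)
    (μ : Measure (EuclideanSpace ℝ (Fin d))) (ν : Measure (EuclideanSpace ℝ (Fin m))) : Prop :=
  ∃ L U : ℝ, ∀ x ∈ μ.support, ∀ᵐ e ∂ν, g x e ∈ Set.Icc L U

/-- Assumption A4: for every input `x`, the law of `g(x, ε)` has a density, bounded below by a
positive constant `C_g(x)` on its support. -/
def AssumptionA4 (g : EuclideanSpace ℝ (Fin d) → EuclideanSpace ℝ (Fin m) → ℝ)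
    (μ : Measure (EuclideanSpace ℝ (Fin d))) (ν : Measure (EuclideanSpace ℝ (Fin m))) : Prop :=
  ∀ x ∈ μ.support, ∃ C : ℝ, 0 < C ∧ HasDensityBoundedBelow (codeLaw g ν x) C

/-- The set `S` has positive lower Lebesgue density at `x`: it fills at least a fixed positive
proportion of every small ball centred at `x`. -/
def ThickAt (S : Set (EuclideanSpace ℝ (Fin d))) (x : EuclideanSpace ℝ (Fin d)) : Prop :=
  ∃ c r₀ : ℝ, 0 < c ∧ 0 < r₀ ∧ ∀ r : ℝ, 0 < r → r ≤ r₀ →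
    ENNReal.ofReal c * volume (Metric.closedBall x r) ≤ volume (S ∩ Metric.closedBall x r)

/-- The order statistic `‖X - x‖_{(k,n)}`: the `k`-th smallest of the distances to `x` of the first
`n` points `X 0, …, X (n - 1)` (and `∞` if there are fewer than `k` points). -/
def kthDist (X : ℕ → EuclideanSpace ℝ (Fin d)) (x : EuclideanSpace ℝ (Fin d)) (k n : ℕ) : ℝ≥0∞ :=
  sInf {r : ℝ≥0∞ | k ≤ #{i ∈ range n | edist (X i) x ≤ r}}

/-- The number of neighbours `k_n = ⌊n^β⌋`. -/
def numNeighbours (β : ℝ) (n : ℕ) : ℕ := ⌊(n : ℝ) ^ β⌋₊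

/-- The step size `γ_n = n^{-γ}`. -/
def stepSize (γ : ℝ) (n : ℕ) : ℝ := (n : ℝ) ^ (-γ)

open Classical in
/-- The estimator `θ_n(x)` computed from the data `(X_i, Y_i)`, `i ≥ 1`, with `X_{n+1}`, `Y_{n+1}`
written `X n`, `Y n`:
`θ_{n+1} = θ_n - γ_{n+1} (1_{Y_{n+1} ≤ θ_n} - α) 1_{‖X_{n+1} - x‖ ≤ ‖X - x‖_{(k_{n+1}, n)}}`. -/
def theta (α β γ θ₀ : ℝ) (x : EuclideanSpace ℝ (Fin d))
    (X : ℕ → EuclideanSpace ℝ (Fin d)) (Y : ℕ → ℝ) : ℕ → ℝ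
  | 0 => θ₀
  | n + 1 => theta α β γ θ₀ x X Y n - stepSize γ (n + 1) *
      ((if Y n ≤ theta α β γ θ₀ x X Y n then 1 else 0) - α) *
      (if edist (X n) x ≤ kthDist X x (numNeighbours β (n + 1)) n then 1 else 0)

/-- `(X_i, ε_i)` is an i.i.d. sequence of pairs with law `μ ⊗ ν` on the probability
space `(Ω, P)`. -/
structure IsSample {Ω : Type*} [MeasurableSpace Ω] (P : Measure Ω)
    (μ : Measure (EuclideanSpace ℝ (Fin d))) (ν : Measure (EuclideanSpace ℝ (Fin m)))
    (X : ℕ → Ω → EuclideanSpace ℝ (Fin d)) (e : ℕ → Ω → EuclideanSpace ℝ (Fin m)) : Prop where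
  measurable_input : ∀ i, Measurable (X i)
  measurable_seed : ∀ i, Measurable (e i)
  map_eq : ∀ i, P.map (fun ω => (X i ω, e i ω)) = μ.prod ν
  indep : iIndepFun (fun i ω => (X i ω, e i ω)) P

/-- The error `θ_n(x) - θ^*(x)` as a random variable, for `Y_i = g(X_i, ε_i)`, where `θ^*(x)` is
the quantile of level `α` of `g(x, ε)`. -/
def error {Ω : Type*} (g : EuclideanSpace ℝ (Fin d) → EuclideanSpace ℝ (Fin m) → ℝ)
    (ν : Measure (EuclideanSpace ℝ (Fin m))) (α β γ θ₀ : ℝ) (x : EuclideanSpace ℝ (Fin d))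
    (X : ℕ → Ω → EuclideanSpace ℝ (Fin d)) (e : ℕ → Ω → EuclideanSpace ℝ (Fin m))
    (n : ℕ) (ω : Ω) : ℝ :=
  theta α β γ θ₀ x (fun i => X i ω) (fun i => g (X i ω) (e i ω)) n
    - quantile (codeLaw g ν x) α

/-- The mean square error `a_n(x) = E[(θ_n(x) - θ^*(x))²]`. -/
def mse {Ω : Type*} [MeasurableSpace Ω] (P : Measure Ω)
    (g : EuclideanSpace ℝ (Fin d) → EuclideanSpace ℝ (Fin m) → ℝ)
    (ν : Measure (EuclideanSpace ℝ (Fin m))) (α β γ θ₀ : ℝ) (x : EuclideanSpace ℝ (Fin d))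
    (X : ℕ → Ω → EuclideanSpace ℝ (Fin d)) (e : ℕ → Ω → EuclideanSpace ℝ (Fin m))
    (n : ℕ) : ℝ :=
  ∫ ω, error g ν α β γ θ₀ x X e n ω ^ 2 ∂P

end StochasticCode

end

noncomputable section

namespace StochasticCode

variable {d m : ℕ}

/-! ### The order statistics and the algorithm -/

/-! The algorithm is a Robbins-Monro scheme whose effective gain is random: given the past, a step
happens with probability `p`, the `μ`-mass of the current nearest neighbour ball. Write `q` for the
quantile `θ*(x)`, `D = θ_n - q`, `w` for the step size. The fresh pair is independent of the past,
so expanding the square and integrating over that pair alone bounds the conditional mean of the next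
squared error by `D² - 2wc·pD² + 2wK₀K·p^(1 + 1/d) + w²p`. Three facts enter. The drift `c·D²` comes
from the growth of the distribution function at its quantile (`exists_mul_sq_le_of_density`); it
needs `D` bounded, which holds since the iterates cannot leave the range of the outputs by more than
one step (`theta_mem_Icc`). The bias is of order `p` times the radius, and a ball of mass `p` has
radius at most of order `p^(1/d)` (`exists_bias_le`). The last term is the squared increment. Since
`D` and `p` both depend on the past, the mean of `pD²` does not factor. Chernoff bounds give `p ≥
n^(-ε)` outside an event of negligible probability as soon as `ε > 1 - β`, and moments of `p` of
order that of powers of `n^(β-1)`. Hence, up to constants, `a_{n+1} ≤ (1 - 2c n^(-γ-ε)) a_n + C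
n^(-γ-η)`, where `η` is the smaller of the bias exponent `(1 + 1/d)(1 - β)` and the variance
exponent `γ + 1 - β`. As `γ + ε < 1`, such a recursion decays like `n^(-(η-ε))`
(`exists_le_rpow_of_recursion`). The two regimes correspond to which exponent is the smaller. -/

/-- Finite infima and suprema of distances make measurability immediate; for `k > n` the infimum is
empty, hence `∞`. -/
lemma kthDist_eq_iInf (X : ℕ → EuclideanSpace ℝ (Fin d)) (x : EuclideanSpace ℝ (Fin d))
    (k n : ℕ) :
    kthDist X x k n = ⨅ T ∈ powersetCard k (range n), ⨆ i ∈ T, edist (X i) x := by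
  classical
  refine le_antisymm ?_ ?_
  · refine le_iInf₂ fun T hT => sInf_le ?_
    rw [mem_powersetCard] at hT
    refine hT.2.symm.le.trans (card_le_card fun i hi => ?_)
    exact mem_filter.2 ⟨hT.1 hi, le_iSup₂ (f := fun i (_ : i ∈ T) => edist (X i) x) i hi⟩
  · refine le_sInf fun r hr => ?_
    obtain ⟨T, hT, hTk⟩ := exists_subset_card_eq (hr : k ≤ #{i ∈ range n | edist (X i) x ≤ r})
    refine (iInf₂_le T (mem_powersetCard.2 ⟨hT.trans (filter_subset _ _), hTk⟩)).trans ?_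
    exact iSup₂_le fun i hi => (mem_filter.1 (hT hi)).2

lemma le_card_of_kthDist_lt {X : ℕ → EuclideanSpace ℝ (Fin d)} {x : EuclideanSpace ℝ (Fin d)}
    {k n : ℕ} {r : ℝ≥0∞} (h : kthDist X x k n < r) :
    k ≤ #{i ∈ range n | edist (X i) x ≤ r} := by
  obtain ⟨s, hs, hsr⟩ := sInf_lt_iff.1 h
  refine le_trans (hs : k ≤ #{i ∈ range n | edist (X i) x ≤ s})
    (card_le_card fun i hi => ?_)
  rw [mem_filter] at hi ⊢
  exact ⟨hi.1, hi.2.trans hsr.le⟩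

lemma card_lt_of_lt_kthDist {X : ℕ → EuclideanSpace ℝ (Fin d)} {x : EuclideanSpace ℝ (Fin d)}
    {k n : ℕ} {r : ℝ≥0∞} (h : r < kthDist X x k n) :
    #{i ∈ range n | edist (X i) x ≤ r} < k := by
  by_contra hk
  exact notMem_of_lt_csInf h (OrderBot.bddBelow _) (not_lt.1 hk)

lemma measurable_kthDist {Ω : Type*} [MeasurableSpace Ω]
    {X : ℕ → Ω → EuclideanSpace ℝ (Fin d)} (x : EuclideanSpace ℝ (Fin d)) (k n : ℕ)
    (hX : ∀ i < n, Measurable (X i)) :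
    Measurable fun ω => kthDist (fun i => X i ω) x k n := by
  simp_rw [kthDist_eq_iInf]
  refine Measurable.biInf _ (Set.to_countable _) fun T hT => ?_
  refine Measurable.biSup _ (Set.to_countable _) fun i hi => ?_
  have := hX i (mem_range.1 ((mem_powersetCard.1 hT).1 hi))
  fun_prop

lemma measurable_theta {Ω : Type*} [MeasurableSpace Ω] (α β γ θ₀ : ℝ)
    {X : ℕ → Ω → EuclideanSpace ℝ (Fin d)} {Y : ℕ → Ω → ℝ} (x : EuclideanSpace ℝ (Fin d))
    (n : ℕ) (hX : ∀ i < n, Measurable (X i)) (hY : ∀ i < n, Measurable (Y i)) :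
    Measurable fun ω => theta α β γ θ₀ x (fun i => X i ω) (fun i => Y i ω) n := by
  classical
  induction n with
  | zero => exact measurable_const
  | succ n ih =>
    have h1 := ih (fun i hi => hX i (by omega)) (fun i hi => hY i (by omega))
    have h2 := measurable_kthDist x (numNeighbours β (n + 1)) n
      (fun i hi => hX i (Nat.lt_succ_of_lt hi))
    have h3 := hX n (Nat.lt_succ_self n)
    have h4 := hY n (Nat.lt_succ_self n)
    simp only [theta]
    refine h1.sub ((measurable_const.mul ((Measurable.ite (measurableSet_le h4 h1)
      measurable_const measurable_const).sub measurable_const)).mul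
      (Measurable.ite (measurableSet_le ?_ h2) measurable_const measurable_const))
    fun_prop

lemma stepSize_nonneg (γ : ℝ) (n : ℕ) : 0 ≤ stepSize γ n :=
  Real.rpow_nonneg (Nat.cast_nonneg n) _

lemma stepSize_succ_le_one {γ : ℝ} (hγ : 0 ≤ γ) (n : ℕ) : stepSize γ (n + 1) ≤ 1 :=
  Real.rpow_le_one_of_one_le_of_nonpos (by push_cast; linarith [n.cast_nonneg (α := ℝ)])
    (by linarith)

lemma theta_mem_Icc {α β γ θ₀ : ℝ} {x : EuclideanSpace ℝ (Fin d)}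
    {X : ℕ → EuclideanSpace ℝ (Fin d)} {Y : ℕ → ℝ} {a b : ℝ} (hα : 0 ≤ α) (hα' : α ≤ 1)
    (hγ : 0 ≤ γ) (hθ₀ : θ₀ ∈ Set.Icc a b) (hY : ∀ i, Y i ∈ Set.Icc a b) (n : ℕ) :
    theta α β γ θ₀ x X Y n ∈ Set.Icc (a - 1) (b + 1) := by
  induction n with
  | zero => exact ⟨by simp only [theta]; linarith [hθ₀.1], by simp only [theta]; linarith [hθ₀.2]⟩
  | succ n ih =>
    have h0 := stepSize_nonneg γ (n + 1)
    have h1 := stepSize_succ_le_one hγ n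
    obtain ⟨h2, h3⟩ := hY n
    obtain ⟨h4, h5⟩ := ih
    simp only [theta]
    -- Above `b` the indicator is `1` and the move is downward; below `a` it is `0` and the move is
    -- upward. Only a start inside `[a, b]` can overshoot, by at most one step of size at most `1`.
    generalize theta α β γ θ₀ x X Y n = t at *
    generalize stepSize γ (n + 1) = s at *
    split_ifs <;> constructor <;> nlinarith

/-! ### Distribution functions and quantiles -/

lemma continuous_cdf (ρ : Measure ℝ) [IsProbabilityMeasure ρ] [NullSingletonClass ρ] :
    Continuous (cdf ρ) := by
  refine continuous_iff_continuousAt.2 fun a => ?_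
  rw [(monotone_cdf ρ).continuousAt_iff_leftLim_eq_rightLim, StieltjesFunction.rightLim_eq]
  refine le_antisymm ((monotone_cdf ρ).leftLim_le le_rfl) ?_
  have h : (cdf ρ).measure {a} = 0 := by rw [measure_cdf]; exact measure_singleton a
  rw [StieltjesFunction.measure_singleton, ENNReal.ofReal_eq_zero] at h
  linarith

section Quantile

variable {ρ : Measure ℝ} {α : ℝ}

lemma quantile_bddBelow (hα : 0 < α) : BddBelow {t : ℝ | α ≤ cdf ρ t} := by
  obtain ⟨b, hb⟩ := ((tendsto_cdf_atBot ρ).eventually (gt_mem_nhds hα)).exists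
  refine ⟨b, fun t ht => ?_⟩
  by_contra! hlt
  exact absurd (lt_of_le_of_lt (le_trans (show α ≤ cdf ρ t from ht) (monotone_cdf ρ hlt.le)) hb)
    (lt_irrefl _)

lemma cdf_quantile [IsProbabilityMeasure ρ] [NullSingletonClass ρ] (hα : 0 < α) (hα' : α < 1) : cdf ρ (quantile ρ α) = α := by
  have hc := continuous_cdf ρ
  obtain ⟨b, hb⟩ := ((tendsto_cdf_atTop ρ).eventually (lt_mem_nhds hα')).exists
  have hne : {t : ℝ | α ≤ cdf ρ t}.Nonempty := ⟨b, hb.le⟩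
  refine le_antisymm ?_ ?_
  · refine le_of_tendsto (hc.continuousWithinAt (s := Set.Iio (quantile ρ α))) ?_
    filter_upwards [self_mem_nhdsWithin] with t ht
    by_contra! h
    exact notMem_of_lt_csInf ht (quantile_bddBelow hα) h.le
  · exact (isClosed_le continuous_const hc).csInf_mem hne (quantile_bddBelow hα)

/-- Were a neighbourhood of the quantile null, the distribution function would already equal `α`
slightly to its left, against the infimum. -/
lemma quantile_mem_support [IsProbabilityMeasure ρ] [NullSingletonClass ρ] (hα : 0 < α) (hα' : α < 1) :
    quantile ρ α ∈ ρ.support := by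
  by_contra h
  obtain ⟨U, hU, hU0⟩ := Measure.notMem_support_iff_exists.1 h
  obtain ⟨δ, hδ, hδU⟩ := Metric.mem_nhds_iff.1 hU
  have hI : ρ (Set.Ioc (quantile ρ α - δ / 2) (quantile ρ α)) = 0 := by
    refine measure_mono_null (fun t ht => hδU ?_) hU0
    rw [Metric.mem_ball, Real.dist_eq, abs_lt]
    constructor <;> linarith [ht.1, ht.2]
  have h2 : (cdf ρ).measure (Set.Ioc (quantile ρ α - δ / 2) (quantile ρ α)) = 0 := by
    rw [measure_cdf, hI]
  rw [StieltjesFunction.measure_Ioc, ENNReal.ofReal_eq_zero, cdf_quantile hα hα'] at h2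
  have : quantile ρ α ≤ quantile ρ α - δ / 2 :=
    csInf_le (quantile_bddBelow hα) (show α ≤ _ by linarith)
  linarith

/-- A density bounded below on an interval support makes the distribution function grow at least
linearly on that support. -/
lemma mul_sub_le_cdf_sub [IsProbabilityMeasure ρ] {c s t : ℝ} (hc : 0 ≤ c) (hρ : HasDensityBoundedBelow ρ c)
    (hS : Set.Icc s t ⊆ ρ.support) (hst : s ≤ t) : c * (t - s) ≤ cdf ρ t - cdf ρ s := by
  obtain ⟨f, hf, hρf, hfc⟩ := hρ
  have h1 : ENNReal.ofReal (c * (t - s)) ≤ ρ (Set.Ioc s t) := by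
    calc ENNReal.ofReal (c * (t - s)) = ∫⁻ _ in Set.Ioc s t, ENNReal.ofReal c := by
          rw [setLIntegral_const, Real.volume_Ioc, ENNReal.ofReal_mul hc]
      _ ≤ ∫⁻ z in Set.Ioc s t, f z :=
          setLIntegral_mono hf fun z hz => hfc z (hS ⟨hz.1.le, hz.2⟩)
      _ = ρ (Set.Ioc s t) := by rw [← withDensity_apply f measurableSet_Ioc, ← hρf]
  rw [← measure_cdf ρ, StieltjesFunction.measure_Ioc] at h1
  exact (ENNReal.ofReal_le_ofReal_iff (sub_nonneg.2 (monotone_cdf ρ hst))).1 h1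

/-- Around its quantile, a distribution function with interval support and density bounded below
on the support is uniformly monotone on bounded sets. -/
lemma exists_mul_sq_le_of_density [IsProbabilityMeasure ρ] {C : ℝ} (hC : 0 < C) (hρ : HasDensityBoundedBelow ρ C)
    (hS : ρ.support.OrdConnected) (hα : 0 < α) (hα' : α < 1) {K : ℝ} (hK : 0 < K) :
    ∃ c, 0 < c ∧ ∀ t, |t - quantile ρ α| ≤ K →
      c * (t - quantile ρ α) ^ 2 ≤ (t - quantile ρ α) * (cdf ρ t - α) := by
  have : NullSingletonClass ρ := by
    obtain ⟨f, hf, hρf, hfc⟩ := hρ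
    exact ⟨fun a => hρf ▸ withDensity_absolutelyContinuous _ _ (measure_singleton a)⟩
  have hq := quantile_mem_support (ρ := ρ) hα hα'
  have hFq := cdf_quantile (ρ := ρ) hα hα'
  have hS1 : ρ ρ.supportᶜ = 0 := Measure.support_mem_ae
  -- On the support the slope is at least `C`. Off it, as the support is an interval containing the
  -- quantile, the distribution function is already `0` or `1`: the gap is `α` or `1 - α` over a
  -- distance at most `K`.
  refine ⟨min C (min (α / K) ((1 - α) / K)), by
    have : 0 < 1 - α := by linarith
    positivity, fun t ht => ?_⟩
  set q := quantile ρ α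
  set c := min C (min (α / K) ((1 - α) / K))
  have hcC : c ≤ C := min_le_left _ _
  have hc1 : c * K ≤ α := by
    rw [← le_div_iff₀ hK]; exact (min_le_right _ _).trans (min_le_left _ _)
  have hc2 : c * K ≤ 1 - α := by
    rw [← le_div_iff₀ hK]; exact (min_le_right _ _).trans (min_le_right _ _)
  have hc0 : 0 ≤ c := by
    have : 0 < 1 - α := by linarith
    positivity
  rw [abs_le] at ht
  rcases le_total q t with hqt | htq
  · suffices c * (t - q) ≤ cdf ρ t - α by nlinarith
    by_cases htS : t ∈ ρ.support
    · have := mul_sub_le_cdf_sub hC.le hρ (hS.out hq htS) hqt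
      nlinarith
    · have h1 : cdf ρ t = 1 := by
        have h0 : ρ (Set.Iic t)ᶜ = 0 := measure_mono_null
          (fun s hs hsS => htS (hS.out hq hsS ⟨hqt, (not_le.1 (show ¬ s ≤ t from hs)).le⟩)) hS1
        rw [cdf_eq_real, measureReal_def, (prob_compl_eq_zero_iff measurableSet_Iic).1 h0,
          ENNReal.toReal_one]
      nlinarith
  · suffices α - cdf ρ t ≥ c * (q - t) by nlinarith
    by_cases htS : t ∈ ρ.support
    · have := mul_sub_le_cdf_sub hC.le hρ (hS.out htS hq) htq
      nlinarith
    · have h1 : cdf ρ t = 0 := by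
        rw [cdf_eq_real, measureReal_def, measure_mono_null _ hS1, ENNReal.toReal_zero]
        intro s hs hsS
        exact htS (hS.out hsS hq ⟨hs, htq⟩)
      nlinarith

end Quantile

/-! ### The mass of small balls -/

/-- Spheres are null, so the mass is continuous in the radius and takes every intermediate value.
This turns events on the mass of a random ball into counts in a fixed ball. -/
lemma exists_real_closedEBall_eq (hd : 0 < d) {μ : Measure (EuclideanSpace ℝ (Fin d))}
    [IsProbabilityMeasure μ] (hμ : μ ≪ volume) (x : EuclideanSpace ℝ (Fin d)) {s : ℝ}
    (hs : 0 < s) (hs' : s < 1) : ∃ r : ℝ≥0∞, μ.real (Metric.closedEBall x r) = s := by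
  have : Nonempty (Fin d) := ⟨⟨0, hd⟩⟩
  have hm : Measurable fun y : EuclideanSpace ℝ (Fin d) => dist y x := by fun_prop
  have : IsProbabilityMeasure (μ.map fun y => dist y x) :=
    Measure.isProbabilityMeasure_map hm.aemeasurable
  have hcdf : ∀ t, cdf (μ.map fun y => dist y x) t = μ.real (Metric.closedBall x t) := fun t => by
    rw [cdf_eq_real, map_measureReal_apply hm measurableSet_Iic]; rfl
  have : NullSingletonClass (μ.map fun y => dist y x) := ⟨fun a => by
    rw [Measure.map_apply hm (measurableSet_singleton a)]
    exact hμ (Measure.addHaar_sphere _ x a)⟩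
  have hc := continuous_cdf (μ.map fun y => dist y x)
  obtain ⟨a, ha⟩ := ((tendsto_cdf_atBot (μ.map fun y => dist y x)).eventually
    (gt_mem_nhds hs)).exists
  obtain ⟨b, hb⟩ := ((tendsto_cdf_atTop (μ.map fun y => dist y x)).eventually
    (lt_mem_nhds hs')).exists
  obtain ⟨t, ht⟩ := mem_range_of_exists_le_of_exists_ge hc ⟨a, ha.le⟩ ⟨b, hb.le⟩
  rw [hcdf] at ht
  have ht0 : 0 ≤ t := by
    by_contra! h
    rw [Metric.closedBall_eq_empty.2 h, measureReal_empty] at ht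
    exact hs.ne ht
  exact ⟨ENNReal.ofReal t, by rw [Metric.closedEBall_ofReal ht0, ht]⟩

/-- The density bound holds on the part of the ball inside the support, and thickness gives that
part a volume of order `r ^ d`. Read backwards, it bounds a radius by a mass. -/
lemma exists_mul_pow_le_real_closedBall {μ : Measure (EuclideanSpace ℝ (Fin d))}
    [IsProbabilityMeasure μ] (hμ : AssumptionA2 μ) {x : EuclideanSpace ℝ (Fin d)}
    (hx : ThickAt μ.support x) :
    ∃ c r₀ : ℝ, 0 < c ∧ 0 < r₀ ∧ ∀ r, 0 < r → r ≤ r₀ →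
      c * r ^ d ≤ μ.real (Metric.closedBall x r) := by
  obtain ⟨C, hC, f, hf, hμf, hfC⟩ := hμ
  obtain ⟨c, r₀, hc, hr₀, h⟩ := hx
  have hv : 0 < (volume : Measure (EuclideanSpace ℝ (Fin d))).real (Metric.closedBall 0 1) :=
    ENNReal.toReal_pos (Metric.measure_closedBall_pos volume _ one_pos).ne'
      measure_closedBall_lt_top.ne
  refine ⟨C * (c * volume.real (Metric.closedBall (0 : EuclideanSpace ℝ (Fin d)) 1)), r₀,
    by positivity, hr₀, fun r hr hr' => ?_⟩
  have hS : MeasurableSet (μ.support ∩ Metric.closedBall x r) :=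
    Measure.isClosed_support.measurableSet.inter measurableSet_closedBall
  have h1 : ENNReal.ofReal C * (ENNReal.ofReal c * volume (Metric.closedBall x r))
      ≤ μ (Metric.closedBall x r) := by
    calc _ ≤ ENNReal.ofReal C * volume (μ.support ∩ Metric.closedBall x r) := by
          gcongr; exact h r hr hr'
      _ = ∫⁻ _ in μ.support ∩ Metric.closedBall x r, ENNReal.ofReal C := by
          rw [setLIntegral_const]
      _ ≤ ∫⁻ z in μ.support ∩ Metric.closedBall x r, f z :=
          setLIntegral_mono hf fun z hz => hfC z hz.1
      _ = μ (μ.support ∩ Metric.closedBall x r) := by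
          rw [← withDensity_apply f hS, ← hμf]
      _ ≤ _ := measure_mono Set.inter_subset_right
  have h2 := ENNReal.toReal_mono (measure_ne_top _ _) h1
  rw [ENNReal.toReal_mul, ENNReal.toReal_mul, ENNReal.toReal_ofReal hC.le,
    ENNReal.toReal_ofReal hc.le, Measure.addHaar_closedBall' _ _ hr.le, ENNReal.toReal_mul,
    ENNReal.toReal_ofReal (by positivity), finrank_euclideanSpace_fin] at h2
  rw [measureReal_def, measureReal_def]
  linarith

lemma real_closedBall_mul_cdf_condCodeLaw
    {g : EuclideanSpace ℝ (Fin d) → EuclideanSpace ℝ (Fin m) → ℝ}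
    (hg : Measurable (Function.uncurry g))
    {μ : Measure (EuclideanSpace ℝ (Fin d))} [IsProbabilityMeasure μ]
    {ν : Measure (EuclideanSpace ℝ (Fin m))} [IsProbabilityMeasure ν]
    {x : EuclideanSpace ℝ (Fin d)} {r : ℝ} (hr : 0 < μ.real (Metric.closedBall x r)) (t : ℝ) :
    (μ.prod ν).real {p | p.1 ∈ Metric.closedBall x r ∧ g p.1 p.2 ≤ t} =
      μ.real (Metric.closedBall x r) * cdf (condCodeLaw g μ ν x r) t := by
  have hB : MeasurableSet {p : EuclideanSpace ℝ (Fin d) × EuclideanSpace ℝ (Fin m) |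
      p.1 ∈ Metric.closedBall x r} := measurable_fst measurableSet_closedBall
  have hBm : (μ.prod ν) {p | p.1 ∈ Metric.closedBall x r} = μ (Metric.closedBall x r) := by
    have := Measure.prod_prod (μ := μ) (ν := ν) (Metric.closedBall x r) Set.univ
    rw [measure_univ, mul_one] at this
    rw [← this]; congr 1; ext p; simp
  have hne : (μ.prod ν) {p | p.1 ∈ Metric.closedBall x r} ≠ 0 := by
    rw [hBm]; intro h; rw [measureReal_def, h] at hr; simp at hr
  have : IsProbabilityMeasure (cond (μ.prod ν) {p | p.1 ∈ Metric.closedBall x r}) :=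
    cond_isProbabilityMeasure hne
  have hgm : Measurable fun p : EuclideanSpace ℝ (Fin d) × EuclideanSpace ℝ (Fin m) =>
    g p.1 p.2 := hg
  have : IsProbabilityMeasure (condCodeLaw g μ ν x r) :=
    Measure.isProbabilityMeasure_map hgm.aemeasurable
  rw [cdf_eq_real, condCodeLaw, map_measureReal_apply hgm measurableSet_Iic, measureReal_def,
    measureReal_def, measureReal_def, cond_apply hB, ENNReal.toReal_mul, ENNReal.toReal_inv, hBm,
    mul_inv_cancel_left₀ (by exact hr.ne')]
  rfl

lemma prod_real_fst (μ : Measure (EuclideanSpace ℝ (Fin d))) [IsProbabilityMeasure μ]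
    (ν : Measure (EuclideanSpace ℝ (Fin m))) [IsProbabilityMeasure ν]
    (B : Set (EuclideanSpace ℝ (Fin d))) :
    (μ.prod ν).real {p | p.1 ∈ B} = μ.real B := by
  have := Measure.prod_prod (μ := μ) (ν := ν) B Set.univ
  rw [measure_univ, mul_one] at this
  rw [measureReal_def, measureReal_def, ← this]
  congr 2; ext p; simp

/-- The bias caused by conditioning on a ball rather than on its centre, in terms of the mass of
the ball. -/
lemma exists_bias_le (hd : 0 < d)
    {g : EuclideanSpace ℝ (Fin d) → EuclideanSpace ℝ (Fin m) → ℝ}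
    (hg : Measurable (Function.uncurry g))
    {μ : Measure (EuclideanSpace ℝ (Fin d))} [IsProbabilityMeasure μ]
    {ν : Measure (EuclideanSpace ℝ (Fin m))} [IsProbabilityMeasure ν]
    (hA1 : AssumptionA1 g μ ν) (hA2 : AssumptionA2 μ)
    {x : EuclideanSpace ℝ (Fin d)} (hx : x ∈ μ.support) (hthick : ThickAt μ.support x) :
    ∃ K : ℝ, 0 ≤ K ∧ ∀ (r : ℝ≥0∞) (t : ℝ),
      |(μ.prod ν).real {p | p.1 ∈ Metric.closedEBall x r ∧ g p.1 p.2 ≤ t}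
        - μ.real (Metric.closedEBall x r) * cdf (codeLaw g ν x) t|
        ≤ K * μ.real (Metric.closedEBall x r) ^ (1 + 1 / (d : ℝ)) := by
  obtain ⟨M, hM⟩ := hA1 x hx
  obtain ⟨c, r₀, hc, hr₀, hcr⟩ := exists_mul_pow_le_real_closedBall hA2 hthick
  have hdn : d ≠ 0 := hd.ne'
  have hmax : ∀ p : ℝ, 0 ≤ p → p ^ (1 + 1 / (d : ℝ)) = p * p ^ (1 / (d : ℝ)) := fun p hp => by
    rw [Real.rpow_add_of_nonneg hp zero_le_one (by positivity), Real.rpow_one]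
  set b : ℝ := c ^ (1 / (d : ℝ))
  have hb : 0 < b := Real.rpow_pos_of_pos hc _
  have hroot : ∀ r p : ℝ, 0 < r → c * r ^ d ≤ p → b * r ≤ p ^ (1 / (d : ℝ)) := by
    intro r p hr hp
    have h1 : b * r = (c * r ^ d) ^ (1 / (d : ℝ)) := by
      rw [Real.mul_rpow hc.le (by positivity), one_div, Real.pow_rpow_inv_natCast hr.le hdn]
      simp only [b, one_div]
    rw [h1]
    exact Real.rpow_le_rpow (by positivity) hp (by positivity)
  -- For `r ≤ r₀`, the radius is at most `p^(1/d) / b`, which converts A1. For larger, possibly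
  -- infinite, radii `b * r₀ ≤ p^(1/d)` makes the trivial bound `p` sufficient.
  refine ⟨max (|M| / b) (1 / (b * r₀)), by positivity, fun r t => ?_⟩
  set K := max (|M| / b) (1 / (b * r₀))
  have hK : 0 ≤ K := by positivity
  set p := μ.real (Metric.closedEBall x r) with hp
  have hp0 : 0 ≤ p := measureReal_nonneg
  rw [hmax p hp0]
  set Q := (μ.prod ν).real {p | p.1 ∈ Metric.closedEBall x r ∧ g p.1 p.2 ≤ t} with hQ
  have hQ0 : 0 ≤ Q := measureReal_nonneg
  have hQp : Q ≤ p := by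
    rw [hp, ← prod_real_fst μ ν]
    exact measureReal_mono fun z hz => hz.1
  have hF0 := cdf_nonneg (codeLaw g ν x) t
  have hF1 := cdf_le_one (codeLaw g ν x) t
  have hcrude : |Q - p * cdf (codeLaw g ν x) t| ≤ p := by
    rw [abs_le]; constructor <;> nlinarith
  -- A1 only concerns positive radii; a ball of radius zero has no mass.
  rcases eq_or_ne r 0 with rfl | hr0
  · have : p = 0 := by
      have hac : μ ≪ volume := by
        obtain ⟨C, hC, f, hf, hμf, hfC⟩ := hA2
        rw [hμf]; exact withDensity_absolutelyContinuous _ _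
      have : Nonempty (Fin d) := ⟨⟨0, hd⟩⟩
      rw [hp, Metric.closedEBall_zero, measureReal_def, hac (measure_singleton x)]
      rfl
    rw [this] at hcrude ⊢
    simpa using hcrude
  rcases le_or_gt r (ENNReal.ofReal r₀) with hr | hr
  · have hrt : r ≠ ∞ := ne_top_of_le_ne_top ENNReal.ofReal_ne_top hr
    have hs0 : 0 < r.toReal := ENNReal.toReal_pos hr0 hrt
    have hs1 : r.toReal ≤ r₀ := ENNReal.toReal_le_of_le_ofReal hr₀.le hr
    have hrB : Metric.closedEBall x r = Metric.closedBall x r.toReal := by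
      conv_lhs => rw [← ENNReal.ofReal_toReal hrt]
      exact Metric.closedEBall_ofReal hs0.le
    have h1 := hcr _ hs0 hs1
    rw [← hrB, ← hp] at h1
    have hp1 : 0 < p := lt_of_lt_of_le (by positivity) h1
    have hQeq : Q = p * cdf (condCodeLaw g μ ν x r.toReal) t := by
      rw [hQ, hp, hrB]
      exact real_closedBall_mul_cdf_condCodeLaw hg (by rw [← hrB]; exact hp1) t
    have h2 := hroot _ _ hs0 h1
    have h3 := hM _ hs0 t
    rw [hQeq, ← mul_sub, abs_mul, abs_of_pos hp1]
    have h4 : |M| / b ≤ K := le_max_left _ _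
    calc p * |cdf (condCodeLaw g μ ν x r.toReal) t - cdf (codeLaw g ν x) t|
        ≤ p * (|M| * r.toReal) := by
          gcongr; exact h3.trans (by gcongr; exact le_abs_self M)
      _ = p * (|M| / b * (b * r.toReal)) := by field_simp
      _ ≤ p * (K * p ^ (1 / (d : ℝ))) := by gcongr
      _ = _ := by ring
  · have h1 := hcr _ hr₀ le_rfl
    have h2 : μ.real (Metric.closedBall x r₀) ≤ p := by
      rw [hp, ← Metric.closedEBall_ofReal hr₀.le]
      exact measureReal_mono (Metric.closedEBall_subset_closedEBall hr.le)
    have h3 := hroot _ _ hr₀ (h1.trans h2)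
    have h4 : 1 / (b * r₀) ≤ K := le_max_right _ _
    calc _ ≤ p * 1 := by rw [mul_one]; exact hcrude
      _ = p * (1 / (b * r₀) * (b * r₀)) := by field_simp
      _ ≤ p * (K * p ^ (1 / (d : ℝ))) := by gcongr
      _ = _ := by ring

/-! ### Chernoff bounds for the number of sample points in a set -/

section Chernoff

variable {Ω : Type*} [MeasurableSpace Ω] {P : Measure Ω} [IsProbabilityMeasure P]
  {E : Type*} [MeasurableSpace E]

lemma integral_exp_mul_indicator {μ : Measure E} [IsProbabilityMeasure μ] {B : Set E}
    (hB : MeasurableSet B) {X : Ω → E} (hX : Measurable X) (hXμ : P.map X = μ) (t : ℝ) :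
    mgf (fun ω => B.indicator (fun _ => (1 : ℝ)) (X ω)) P t
      = 1 + μ.real B * (Real.exp t - 1) := by
  have h : (fun ω => Real.exp (t * B.indicator (fun _ => (1 : ℝ)) (X ω)))
      = fun ω => 1 + (X ⁻¹' B).indicator (fun _ => Real.exp t - 1) ω := by
    ext ω
    by_cases hω : X ω ∈ B
    · rw [Set.indicator_of_mem hω, Set.indicator_of_mem (show ω ∈ X ⁻¹' B from hω)]; simp
    · rw [Set.indicator_of_notMem hω, Set.indicator_of_notMem (show ω ∉ X ⁻¹' B from hω)]; simp
  rw [mgf, h, integral_add (integrable_const _)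
    ((integrable_const _).indicator (hX hB)), integral_indicator_const _ (hX hB),
    ← hXμ, map_measureReal_apply hX hB]
  simp

open Classical in
lemma card_filter_mem_eq_sum {Ω E : Type*} (B : Set E) (X : ℕ → Ω → E) (n : ℕ) (ω : Ω) :
    ((#{i ∈ range n | X i ω ∈ B} : ℕ) : ℝ)
      = (∑ i ∈ range n, fun ω => B.indicator (fun _ => (1 : ℝ)) (X i ω)) ω := by
  rw [Finset.sum_apply, card_filter]
  push_cast
  exact sum_congr rfl fun i _ => by rw [Set.indicator_apply]

/-- Independence and `1 + u ≤ exp u` bound the binomial transform by the Poisson one. -/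
lemma mgf_sum_indicator_le {μ : Measure E} [IsProbabilityMeasure μ] {B : Set E}
    (hB : MeasurableSet B) {X : ℕ → Ω → E} (hX : ∀ i, Measurable (X i))
    (hXμ : ∀ i, P.map (X i) = μ) (hind : iIndepFun X P) (n : ℕ) (t : ℝ) :
    mgf (∑ i ∈ range n, fun ω => B.indicator (fun _ => (1 : ℝ)) (X i ω)) P t
      ≤ Real.exp (n * μ.real B * (Real.exp t - 1)) := by
  have hBm : Measurable (B.indicator (fun _ => (1 : ℝ))) := measurable_const.indicator hB
  have hind' : iIndepFun (fun i ω => B.indicator (fun _ => (1 : ℝ)) (X i ω)) P :=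
    hind.comp (fun _ => B.indicator (fun _ => (1 : ℝ))) fun _ => hBm
  rw [hind'.mgf_sum fun i => hBm.comp (hX i)]
  rw [prod_congr rfl fun i _ => integral_exp_mul_indicator hB (hX i) (hXμ i) t, prod_const,
    card_range, mul_assoc, Real.exp_nat_mul]
  have h1 : μ.real B ≤ 1 := measureReal_le_one
  have h0 : 0 ≤ μ.real B := measureReal_nonneg
  refine pow_le_pow_left₀ ?_ (by linarith [Real.add_one_le_exp (μ.real B * (Real.exp t - 1))]) n
  nlinarith [Real.exp_pos t]

open Classical in
lemma integrable_exp_sum_indicator {B : Set E} (hB : MeasurableSet B) {X : ℕ → Ω → E}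
    (hX : ∀ i, Measurable (X i)) (n : ℕ) (t : ℝ) :
    Integrable (fun ω => Real.exp
      (t * (∑ i ∈ range n, fun ω => B.indicator (fun _ => (1 : ℝ)) (X i ω)) ω)) P := by
  have hBm : Measurable (B.indicator (fun _ => (1 : ℝ))) := measurable_const.indicator hB
  have hm : Measurable (∑ i ∈ range n, fun ω => B.indicator (fun _ => (1 : ℝ)) (X i ω)) :=
    by
      rw [Finset.sum_fn]
      exact Finset.measurable_sum _ fun i _ => hBm.comp (hX i)
  refine Integrable.of_bound (C := Real.exp (|t| * n)) (by fun_prop) (.of_forall fun ω => ?_)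
  rw [Real.norm_eq_abs, Real.abs_exp, ← card_filter_mem_eq_sum]
  refine Real.exp_le_exp.2 (le_trans (le_abs_self _) ?_)
  rw [abs_mul, Nat.abs_cast]
  gcongr
  exact (card_filter_le _ _).trans (card_range n).le

open Classical in
-- Exponential Markov inequality at `t = 1`, with `e - 1 ≤ 2`.
lemma real_le_card_le_exp {μ : Measure E} [IsProbabilityMeasure μ] {B : Set E}
    (hB : MeasurableSet B) {X : ℕ → Ω → E} (hX : ∀ i, Measurable (X i))
    (hXμ : ∀ i, P.map (X i) = μ) (hind : iIndepFun X P) (n k : ℕ) :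
    P.real {ω | k ≤ #{i ∈ range n | X i ω ∈ B}} ≤ Real.exp (2 * n * μ.real B - k) := by
  have h := measure_ge_le_exp_mul_mgf (μ := P) (k : ℝ) zero_le_one
    (integrable_exp_sum_indicator hB hX n 1)
  simp only [← card_filter_mem_eq_sum, Nat.cast_le] at h
  refine h.trans ((mul_le_mul_of_nonneg_left (mgf_sum_indicator_le hB hX hXμ hind n 1)
    (Real.exp_pos _).le).trans ?_)
  rw [← Real.exp_add, Real.exp_le_exp]
  have h1 : Real.exp 1 - 1 ≤ 2 := by linarith [Real.exp_one_lt_d9]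
  have h2 : 0 ≤ n * μ.real B := by positivity
  nlinarith

open Classical in
-- Exponential Markov inequality at `t = -1`, with `1 - 1/e ≥ 1/2`.
lemma real_card_lt_le_exp {μ : Measure E} [IsProbabilityMeasure μ] {B : Set E}
    (hB : MeasurableSet B) {X : ℕ → Ω → E} (hX : ∀ i, Measurable (X i))
    (hXμ : ∀ i, P.map (X i) = μ) (hind : iIndepFun X P) (n k : ℕ) :
    P.real {ω | #{i ∈ range n | X i ω ∈ B} < k} ≤ Real.exp (k - n * μ.real B / 2) := by
  have h := measure_le_le_exp_mul_mgf (μ := P) (k : ℝ) (show (-1 : ℝ) ≤ 0 by norm_num)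
    (integrable_exp_sum_indicator hB hX n (-1))
  simp only [← card_filter_mem_eq_sum, Nat.cast_le] at h
  refine (measureReal_mono (fun ω (hω : _ < k) => (hω.le : _ ≤ k)) (measure_ne_top _ _)).trans (h.trans
    ((mul_le_mul_of_nonneg_left (mgf_sum_indicator_le hB hX hXμ hind n (-1))
    (Real.exp_pos _).le).trans ?_))
  rw [← Real.exp_add, Real.exp_le_exp]
  have h1 : Real.exp (-1) ≤ 1 / 2 := by
    rw [Real.exp_neg, inv_le_comm₀ (Real.exp_pos 1) (by norm_num)]
    linarith [Real.add_one_le_exp (1 : ℝ)]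
  have h2 : 0 ≤ n * μ.real B := by positivity
  nlinarith

end Chernoff

/-! ### Concentration of the mass of the nearest neighbour ball -/

section Mass

variable {Ω : Type*} [MeasurableSpace Ω] {P : Measure Ω} [IsProbabilityMeasure P]
  {μ : Measure (EuclideanSpace ℝ (Fin d))} [IsProbabilityMeasure μ]
  {X : ℕ → Ω → EuclideanSpace ℝ (Fin d)}

lemma measurableSet_closedEBall (x : EuclideanSpace ℝ (Fin d)) (r : ℝ≥0∞) :
    MeasurableSet (Metric.closedEBall x r) := by
  have : Measurable fun y => edist y x := by fun_prop
  exact this measurableSet_Iic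

/-- Take a fixed ball of mass exactly `s`: a nearest neighbour ball of smaller mass has smaller
radius, so the fixed ball holds at least `k` points. -/
lemma real_mass_lt_le (hd : 0 < d) (hμ : μ ≪ volume) (hX : ∀ i, Measurable (X i))
    (hXμ : ∀ i, P.map (X i) = μ) (hind : iIndepFun X P) (x : EuclideanSpace ℝ (Fin d))
    (k n : ℕ) {s : ℝ} (hs : 0 < s) (hs' : s < 1) :
    P.real {ω | μ.real (Metric.closedEBall x (kthDist (fun i => X i ω) x k n)) < s}
      ≤ Real.exp (2 * n * s - k) := by
  classical
  obtain ⟨r, hr⟩ := exists_real_closedEBall_eq hd hμ x hs hs'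
  have h := real_le_card_le_exp (measurableSet_closedEBall x r) hX hXμ hind n k
  rw [hr] at h
  refine (measureReal_mono fun ω (hω : _ < s) => ?_).trans h
  have hlt : kthDist (fun i => X i ω) x k n < r := by
    by_contra! hle
    have := measureReal_mono (μ := μ) (Metric.closedEBall_subset_closedEBall (x := x) hle)
    linarith
  have h2 := le_card_of_kthDist_lt hlt
  simp only [Set.mem_ofPred_eq, Metric.mem_closedEBall]
  convert h2

/-- Dually, a larger mass means that the ball of mass `s` holds fewer than `k` points; for `s ≥ 1`
the event is empty. -/
lemma real_lt_mass_le (hd : 0 < d) (hμ : μ ≪ volume) (hX : ∀ i, Measurable (X i))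
    (hXμ : ∀ i, P.map (X i) = μ) (hind : iIndepFun X P) (x : EuclideanSpace ℝ (Fin d))
    (k n : ℕ) {s : ℝ} (hs : 0 < s) :
    P.real {ω | s < μ.real (Metric.closedEBall x (kthDist (fun i => X i ω) x k n))}
      ≤ Real.exp (k - n * s / 2) := by
  classical
  rcases le_or_gt 1 s with h1 | hs'
  · have : {ω | s < μ.real (Metric.closedEBall x (kthDist (fun i => X i ω) x k n))} = ∅ := by
      ext ω
      have : μ.real (Metric.closedEBall x (kthDist (fun i => X i ω) x k n)) ≤ 1 :=
        measureReal_le_one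
      simp only [Set.mem_ofPred_eq, Set.mem_empty_iff_false, iff_false, not_lt]
      linarith
    rw [this, measureReal_empty]
    positivity
  obtain ⟨r, hr⟩ := exists_real_closedEBall_eq hd hμ x hs hs'
  have h := real_card_lt_le_exp (measurableSet_closedEBall x r) hX hXμ hind n k
  rw [hr] at h
  refine (measureReal_mono fun ω (hω : s < _) => ?_).trans h
  have hlt : r < kthDist (fun i => X i ω) x k n := by
    by_contra! hle
    have := measureReal_mono (μ := μ) (Metric.closedEBall_subset_closedEBall (x := x) hle)
    linarith
  have h2 := card_lt_of_lt_kthDist hlt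
  simp only [Set.mem_ofPred_eq, Metric.mem_closedEBall]
  convert h2

lemma measurable_mass (x : EuclideanSpace ℝ (Fin d)) :
    Measurable fun r : ℝ≥0∞ => μ.real (Metric.closedEBall x r) := by
  have : Monotone fun r : ℝ≥0∞ => μ.real (Metric.closedEBall x r) := fun r s hrs =>
    measureReal_mono (Metric.closedEBall_subset_closedEBall hrs)
  exact this.measurable

/-- Moments of a `[0, 1]`-valued variable from a tail bound. -/
lemma integral_rpow_le {p : Ω → ℝ} (hp : Measurable p) (hp0 : ∀ ω, 0 ≤ p ω) (hp1 : ∀ ω, p ω ≤ 1)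
    {q s : ℝ} (hq : 0 ≤ q) (hs : 0 ≤ s) :
    ∫ ω, p ω ^ q ∂P ≤ s ^ q + P.real {ω | s < p ω} := by
  have hS : MeasurableSet {ω | s < p ω} := measurableSet_lt measurable_const hp
  have hint : Integrable (fun ω => p ω ^ q) P :=
    Integrable.of_bound (C := 1) (hp.pow_const q).aestronglyMeasurable (.of_forall fun ω => by
      rw [Real.norm_eq_abs, abs_of_nonneg (Real.rpow_nonneg (hp0 ω) _)]
      exact Real.rpow_le_one (hp0 ω) (hp1 ω) hq)
  have hi2 : Integrable ({ω | s < p ω}.indicator fun _ => (1 : ℝ)) P :=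
    (integrable_const _).indicator hS
  calc ∫ ω, p ω ^ q ∂P ≤ ∫ ω, (s ^ q + {ω | s < p ω}.indicator (fun _ => (1 : ℝ)) ω) ∂P := by
        refine integral_mono hint ((integrable_const _).add hi2) fun ω => ?_
        by_cases h : s < p ω
        · simp only [Set.indicator_of_mem (show ω ∈ {ω | s < p ω} from h)]
          linarith [Real.rpow_le_one (hp0 ω) (hp1 ω) hq, Real.rpow_nonneg hs q]
        · simp only [Set.indicator_of_notMem (show ω ∉ {ω | s < p ω} from h), add_zero]
          exact Real.rpow_le_rpow (hp0 ω) (not_lt.1 h) hq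
    _ = _ := by
        rw [integral_add (integrable_const _) hi2, integral_indicator_const _ hS]
        simp

end Mass

/-! ### One step of the algorithm -/

section Step

variable {g : EuclideanSpace ℝ (Fin d) → EuclideanSpace ℝ (Fin m) → ℝ}
  {μ : Measure (EuclideanSpace ℝ (Fin d))} {ν : Measure (EuclideanSpace ℝ (Fin m))}
  {Ω : Type*} [MeasurableSpace Ω] {P : Measure Ω}
  {X : ℕ → Ω → EuclideanSpace ℝ (Fin d)} {e : ℕ → Ω → EuclideanSpace ℝ (Fin m)}

lemma IsSample.map_input [IsProbabilityMeasure ν] (h : IsSample P μ ν X e) (i : ℕ) : P.map (X i) = μ := by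
  have h1 : X i = Prod.fst ∘ fun ω => (X i ω, e i ω) := rfl
  have h2 := Measure.fst_prod (μ := μ) (ν := ν)
  rw [Measure.fst] at h2
  rw [h1, ← Measure.map_map measurable_fst
    ((h.measurable_input i).prodMk (h.measurable_seed i)), h.map_eq, h2]

lemma IsSample.iIndepFun_input (h : IsSample P μ ν X e) : iIndepFun X P :=
  h.indep.comp (fun _ => Prod.fst) fun _ => measurable_fst

lemma IsSample.measurable_output (h : IsSample P μ ν X e)
    (hg : Measurable (Function.uncurry g)) (i : ℕ) : Measurable fun ω => g (X i ω) (e i ω) :=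
  hg.comp ((h.measurable_input i).prodMk (h.measurable_seed i))

lemma ae_abs_error_le [IsProbabilityMeasure ν] (hg : Measurable (Function.uncurry g)) (h : IsSample P μ ν X e)
    (x : EuclideanSpace ℝ (Fin d)) (R : ℝ) {α γ : ℝ} (β : ℝ)
    (hα : 0 ≤ α) (hα' : α ≤ 1) (hγ : 0 ≤ γ) {L U θ₀ : ℝ}
    (hLU : ∀ x ∈ μ.support, ∀ᵐ e ∂ν, g x e ∈ Set.Icc L U) (hθ₀ : |θ₀| ≤ R) :
    ∀ᵐ ω ∂P, ∀ n, |error g ν α β γ θ₀ x X e n ω| ≤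
      1 + |L| + |U| + |R| + |quantile (codeLaw g ν x) α| := by
  have hms : MeasurableSet {z : EuclideanSpace ℝ (Fin d) × EuclideanSpace ℝ (Fin m) |
      g z.1 z.2 ∈ Set.Icc L U} := hg measurableSet_Icc
  have h1 : ∀ᵐ z ∂(μ.prod ν), g z.1 z.2 ∈ Set.Icc L U := by
    rw [Measure.ae_prod_iff_ae_ae hms]
    filter_upwards [Measure.support_mem_ae (μ := μ)] with y hy using hLU y hy
  have h2 : ∀ i, ∀ᵐ ω ∂P, g (X i ω) (e i ω) ∈ Set.Icc L U := fun i => by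
    rw [← h.map_eq i] at h1
    exact ae_of_ae_map ((h.measurable_input i).prodMk (h.measurable_seed i)).aemeasurable h1
  filter_upwards [ae_all_iff.2 h2] with ω hω n
  have h3 := theta_mem_Icc (x := x) (X := fun i => X i ω) (Y := fun i => g (X i ω) (e i ω))
    (a := -(|L| + |U| + |R|)) (b := |L| + |U| + |R|) (β := β) hα hα' hγ
    (by
      rw [abs_le] at hθ₀
      constructor <;> linarith [hθ₀.1, hθ₀.2, le_abs_self R, abs_nonneg L, abs_nonneg U])
    (fun i => by
      have := hω i
      constructor <;> linarith [this.1, this.2, neg_abs_le L, le_abs_self U, abs_nonneg R,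
        abs_nonneg L, abs_nonneg U]) n
  rw [error, abs_le]
  constructor <;> linarith [h3.1, h3.2, le_abs_self (quantile (codeLaw g ν x) α),
    neg_abs_le (quantile (codeLaw g ν x) α)]

lemma measurable_error (hg : Measurable (Function.uncurry g)) (h : IsSample P μ ν X e)
    (α β γ θ₀ : ℝ) (x : EuclideanSpace ℝ (Fin d)) (n : ℕ) :
    Measurable (error g ν α β γ θ₀ x X e n) :=
  (measurable_theta α β γ θ₀ x n (fun i _ => h.measurable_input i)
    fun i _ => h.measurable_output hg i).sub measurable_const

lemma IsSample.indepFun_past (h : IsSample P μ ν X e) (hg : Measurable (Function.uncurry g))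
    (α β γ θ₀ : ℝ) (x : EuclideanSpace ℝ (Fin d)) (k n : ℕ) :
    IndepFun (fun ω => (theta α β γ θ₀ x (fun i => X i ω) (fun i => g (X i ω) (e i ω)) n,
      kthDist (fun i => X i ω) x k n)) (fun ω => (X n ω, e n ω)) P := by
  have hle : ∀ i, MeasurableSpace.comap (fun ω => (X i ω, e i ω)) inferInstance ≤ ‹_› := fun i =>
    ((h.measurable_input i).prodMk (h.measurable_seed i)).comap_le
  have hI := indep_iSup_of_disjoint hle h.indep
    (show Disjoint {i | i < n} {n} by simp)
  rw [IndepFun_iff_Indep]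
  refine indep_of_indep_of_le_right (indep_of_indep_of_le_left hI ?_)
    (le_iSup₂_of_le n rfl le_rfl)
  rw [← measurable_iff_comap_le]
  have hZ : ∀ i < n, Measurable[⨆ j ∈ {i | i < n},
      MeasurableSpace.comap (fun ω => (X j ω, e j ω)) inferInstance]
      fun ω => (X i ω, e i ω) := fun i hi =>
    (measurable_iff_comap_le.2 (le_iSup₂_of_le i hi le_rfl))
  -- The measurability lemmas are applied with the σ-algebra generated by the first `n` pairs in
  -- place of the ambient one.
  refine @Measurable.prodMk _ _ _ _ _ (_) _ _ ?_ ?_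
  · exact @measurable_theta _ _ (_) α β γ θ₀ X (fun i ω => g (X i ω) (e i ω)) x n
      (fun i hi => (Measurable.comp measurable_fst (hZ i hi) :))
      (fun i hi => (Measurable.comp hg (hZ i hi) :))
  · exact @measurable_kthDist _ _ (_) X x k n
      (fun i hi => (Measurable.comp measurable_fst (hZ i hi) :))

variable [IsProbabilityMeasure P]

lemma integrable_error_sq (hg : Measurable (Function.uncurry g)) (h : IsSample P μ ν X e)
    {α β γ θ₀ : ℝ} {x : EuclideanSpace ℝ (Fin d)} {n : ℕ} {K₀ : ℝ}
    (hK₀ : ∀ᵐ ω ∂P, |error g ν α β γ θ₀ x X e n ω| ≤ K₀) :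
    Integrable (fun ω => error g ν α β γ θ₀ x X e n ω ^ 2) P := by
  refine Integrable.of_bound (C := K₀ ^ 2)
    ((measurable_error hg h α β γ θ₀ x n).pow_const 2).aestronglyMeasurable ?_
  filter_upwards [hK₀] with ω hω
  rw [Real.norm_eq_abs, abs_of_nonneg (sq_nonneg _)]
  exact sq_le_sq' (abs_le.1 hω).1 (abs_le.1 hω).2

variable [IsProbabilityMeasure μ] [IsProbabilityMeasure ν]

open Classical in
-- The past is frozen (`t` the iterate, `r` the radius) and only the fresh pair is random.
lemma integral_step_sq_le (hg : Measurable (Function.uncurry g))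
    {x : EuclideanSpace ℝ (Fin d)} {α : ℝ} (hα : 0 ≤ α) (hα' : α ≤ 1) {q t s c K K₀ : ℝ}
    (r : ℝ≥0∞) (hs : 0 ≤ s) (hK₀ : |t - q| ≤ K₀)
    (hc : c * (t - q) ^ 2 ≤ (t - q) * (cdf (codeLaw g ν x) t - α))
    (hK : |(μ.prod ν).real {p | p.1 ∈ Metric.closedEBall x r ∧ g p.1 p.2 ≤ t}
        - μ.real (Metric.closedEBall x r) * cdf (codeLaw g ν x) t|
        ≤ K * μ.real (Metric.closedEBall x r) ^ (1 + 1 / (d : ℝ))) :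
    ∫ z, (t - s * ((if g z.1 z.2 ≤ t then 1 else 0) - α) *
        (if edist z.1 x ≤ r then 1 else 0) - q) ^ 2 ∂(μ.prod ν)
      ≤ (t - q) ^ 2 - 2 * s * c * ((t - q) ^ 2 * μ.real (Metric.closedEBall x r))
        + 2 * s * K₀ * K * μ.real (Metric.closedEBall x r) ^ (1 + 1 / (d : ℝ))
        + s ^ 2 * μ.real (Metric.closedEBall x r) := by
  have hgm : Measurable fun p : EuclideanSpace ℝ (Fin d) × EuclideanSpace ℝ (Fin m) =>
    g p.1 p.2 := hg
  set B : Set (EuclideanSpace ℝ (Fin d) × EuclideanSpace ℝ (Fin m)) :=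
    {p | p.1 ∈ Metric.closedEBall x r} with hBdef
  set A : Set (EuclideanSpace ℝ (Fin d) × EuclideanSpace ℝ (Fin m)) :=
    {p | p.1 ∈ Metric.closedEBall x r ∧ g p.1 p.2 ≤ t} with hAdef
  have hB : MeasurableSet B := measurable_fst (measurableSet_closedEBall x r)
  have hA : MeasurableSet A := hB.inter (measurableSet_le hgm measurable_const)
  have hiB : Integrable (B.indicator fun _ => (1 : ℝ)) (μ.prod ν) :=
    (integrable_const _).indicator hB
  have hiA : Integrable (A.indicator fun _ => (1 : ℝ)) (μ.prod ν) :=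
    (integrable_const _).indicator hA
  have hBr : (μ.prod ν).real B = μ.real (Metric.closedEBall x r) := prod_real_fst μ ν _
  have hp0 : 0 ≤ μ.real (Metric.closedEBall x r) := measureReal_nonneg
  -- The cross term is kept exactly; the squared increment is bounded using `(1 - α)² ≤ 1` and `α² ≤
  -- 1`.
  have hpt : ∀ z : EuclideanSpace ℝ (Fin d) × EuclideanSpace ℝ (Fin m),
      (t - s * ((if g z.1 z.2 ≤ t then 1 else 0) - α) *
        (if edist z.1 x ≤ r then 1 else 0) - q) ^ 2 ≤
      (t - q) ^ 2 - 2 * s * (t - q) * A.indicator (fun _ => (1 : ℝ)) z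
        + (2 * s * (t - q) * α + s ^ 2) * B.indicator (fun _ => (1 : ℝ)) z := by
    intro z
    have hs2 : 0 ≤ s ^ 2 := sq_nonneg s
    by_cases h1 : edist z.1 x ≤ r <;> by_cases h2 : g z.1 z.2 ≤ t
    · have hzB : z ∈ B := h1
      have hzA : z ∈ A := ⟨h1, h2⟩
      rw [if_pos h1, if_pos h2, Set.indicator_of_mem hzB, Set.indicator_of_mem hzA]
      nlinarith [mul_nonneg hs2 (mul_nonneg hα (show 0 ≤ 2 - α by linarith))]
    · have hzB : z ∈ B := h1
      have hzA : z ∉ A := fun h => h2 h.2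
      rw [if_pos h1, if_neg h2, Set.indicator_of_mem hzB, Set.indicator_of_notMem hzA]
      nlinarith [mul_nonneg hs2 (mul_nonneg (show 0 ≤ 1 + α by linarith)
        (show 0 ≤ 1 - α by linarith))]
    · have hzB : z ∉ B := h1
      have hzA : z ∉ A := fun h => h1 h.1
      rw [if_neg h1, Set.indicator_of_notMem hzB, Set.indicator_of_notMem hzA]
      exact le_of_eq (by ring)
    · have hzB : z ∉ B := h1
      have hzA : z ∉ A := fun h => h1 h.1
      rw [if_neg h1, Set.indicator_of_notMem hzB, Set.indicator_of_notMem hzA]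
      exact le_of_eq (by ring)
  have hi1 : Integrable (fun z => (t - q) ^ 2 -
      2 * s * (t - q) * A.indicator (fun _ => (1 : ℝ)) z) (μ.prod ν) :=
    (integrable_const _).sub (hiA.const_mul _)
  have hi2 := hiB.const_mul (2 * s * (t - q) * α + s ^ 2)
  refine (integral_mono_of_nonneg (.of_forall fun z => sq_nonneg _) (hi1.add hi2)
    (.of_forall hpt)).trans ?_
  have hval : ∫ z, ((t - q) ^ 2 - 2 * s * (t - q) * A.indicator (fun _ => (1 : ℝ)) z
        + (2 * s * (t - q) * α + s ^ 2) * B.indicator (fun _ => (1 : ℝ)) z) ∂(μ.prod ν)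
      = (t - q) ^ 2 - 2 * s * (t - q) * (μ.prod ν).real A
        + (2 * s * (t - q) * α + s ^ 2) * μ.real (Metric.closedEBall x r) := by
    rw [integral_add hi1 hi2, integral_sub (integrable_const _) (hiA.const_mul _),
      integral_const_mul, integral_const_mul, integral_indicator_const _ hA,
      integral_indicator_const _ hB, hBr]
    simp
  refine le_trans (le_of_eq hval) ?_
  set p := μ.real (Metric.closedEBall x r)
  set Q := (μ.prod ν).real A
  set F := cdf (codeLaw g ν x) t
  -- The drift splits as `Q - αp = p(F - α) + (Q - pF)`: the first part contracts, the second is the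
  -- bias.
  have h1 : -((t - q) * (Q - p * F)) ≤ K₀ * (K * p ^ (1 + 1 / (d : ℝ))) := by
    refine (neg_le_abs _).trans ?_
    rw [abs_mul]
    exact mul_le_mul hK₀ hK (abs_nonneg _) ((abs_nonneg _).trans hK₀)
  have h2 := mul_le_mul_of_nonneg_right hc hp0
  have h3 := mul_le_mul_of_nonneg_left h1 hs
  have h4 := mul_le_mul_of_nonneg_left h2 hs
  linarith

lemma mse_succ_le (hg : Measurable (Function.uncurry g)) (h : IsSample P μ ν X e)
    {x : EuclideanSpace ℝ (Fin d)} {α β γ θ₀ : ℝ} (hα : 0 ≤ α) (hα' : α ≤ 1) {c K K₀ : ℝ}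
    (hc0 : 0 ≤ c) (hK₀ : ∀ n, ∀ᵐ ω ∂P, |error g ν α β γ θ₀ x X e n ω| ≤ K₀)
    (hc : ∀ t, |t - quantile (codeLaw g ν x) α| ≤ K₀ →
      c * (t - quantile (codeLaw g ν x) α) ^ 2
        ≤ (t - quantile (codeLaw g ν x) α) * (cdf (codeLaw g ν x) t - α))
    (hK : ∀ (r : ℝ≥0∞) (t : ℝ),
      |(μ.prod ν).real {p | p.1 ∈ Metric.closedEBall x r ∧ g p.1 p.2 ≤ t}
        - μ.real (Metric.closedEBall x r) * cdf (codeLaw g ν x) t|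
        ≤ K * μ.real (Metric.closedEBall x r) ^ (1 + 1 / (d : ℝ)))
    (n : ℕ) {s : ℝ} (hs : 0 ≤ s) {p : Ω → ℝ}
    (hp : p = fun ω => μ.real (Metric.closedEBall x
      (kthDist (fun i => X i ω) x (numNeighbours β (n + 1)) n))) :
    mse P g ν α β γ θ₀ x X e (n + 1) ≤
      (1 - 2 * stepSize γ (n + 1) * c * s) * mse P g ν α β γ θ₀ x X e n
      + 2 * stepSize γ (n + 1) * c * s * K₀ ^ 2 * P.real {ω | p ω < s}
      + 2 * stepSize γ (n + 1) * K₀ * K * ∫ ω, p ω ^ (1 + 1 / (d : ℝ)) ∂P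
      + stepSize γ (n + 1) ^ 2 * ∫ ω, p ω ∂P := by
  classical
  set k := numNeighbours β (n + 1)
  set q := quantile (codeLaw g ν x) α with hq
  set w := stepSize γ (n + 1) with hw
  have hw0 : 0 ≤ w := stepSize_nonneg _ _
  set A : Ω → ℝ × ℝ≥0∞ := fun ω =>
    (theta α β γ θ₀ x (fun i => X i ω) (fun i => g (X i ω) (e i ω)) n,
      kthDist (fun i => X i ω) x k n) with hA
  set Z : Ω → EuclideanSpace ℝ (Fin d) × EuclideanSpace ℝ (Fin m) :=
    fun ω => (X n ω, e n ω) with hZ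
  have hind : IndepFun A Z P := h.indepFun_past hg α β γ θ₀ x k n
  have hAm : Measurable A :=
    (measurable_theta α β γ θ₀ x n (fun i _ => h.measurable_input i)
      fun i _ => h.measurable_output hg i).prodMk
    (measurable_kthDist x k n fun i _ => h.measurable_input i)
  have hZm : Measurable Z := (h.measurable_input n).prodMk (h.measurable_seed n)
  have hmap : P.map (fun ω => (A ω, Z ω)) = (P.map A).prod (μ.prod ν) := by
    rw [hind.map_prod_eq_prod_map_map hAm.aemeasurable hZm.aemeasurable, h.map_eq n]
  have hprobA : IsProbabilityMeasure (P.map A) := Measure.isProbabilityMeasure_map hAm.aemeasurable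
  set H : (ℝ × ℝ≥0∞) × (EuclideanSpace ℝ (Fin d) × EuclideanSpace ℝ (Fin m)) → ℝ := fun u =>
    (u.1.1 - w * ((if g u.2.1 u.2.2 ≤ u.1.1 then 1 else 0) - α) *
        (if edist u.2.1 x ≤ u.1.2 then 1 else 0) - q) ^ 2 with hH
  have hHm : Measurable H := by
    have h1 : MeasurableSet {u : (ℝ × ℝ≥0∞) × (EuclideanSpace ℝ (Fin d) ×
        EuclideanSpace ℝ (Fin m)) | g u.2.1 u.2.2 ≤ u.1.1} :=
      measurableSet_le (hg.comp measurable_snd) (by fun_prop)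
    have h2 : MeasurableSet {u : (ℝ × ℝ≥0∞) × (EuclideanSpace ℝ (Fin d) ×
        EuclideanSpace ℝ (Fin m)) | edist u.2.1 x ≤ u.1.2} :=
      measurableSet_le (by fun_prop) (by fun_prop)
    have h3 : Measurable fun u : (ℝ × ℝ≥0∞) × (EuclideanSpace ℝ (Fin d) ×
        EuclideanSpace ℝ (Fin m)) => (if g u.2.1 u.2.2 ≤ u.1.1 then (1 : ℝ) else 0) :=
      Measurable.ite h1 measurable_const measurable_const
    have h4 : Measurable fun u : (ℝ × ℝ≥0∞) × (EuclideanSpace ℝ (Fin d) ×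
        EuclideanSpace ℝ (Fin m)) => (if edist u.2.1 x ≤ u.1.2 then (1 : ℝ) else 0) :=
      Measurable.ite h2 measurable_const measurable_const
    fun_prop
  have herr : ∀ ω, error g ν α β γ θ₀ x X e (n + 1) ω ^ 2 = H (A ω, Z ω) := fun ω => by
    simp only [error, theta, hH, hA, hZ]
    congr!
  have herr0 : ∀ ω, error g ν α β γ θ₀ x X e n ω = (A ω).1 - q := fun ω => rfl
  have hHint : Integrable H ((P.map A).prod (μ.prod ν)) := by
    rw [← hmap, integrable_map_measure hHm.aestronglyMeasurable (hAm.prodMk hZm).aemeasurable]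
    exact (integrable_error_sq hg h (hK₀ (n + 1))).congr (.of_forall herr)
  -- Under the product law of past and fresh pair, Fubini replaces conditioning on the past.
  have hmse : mse P g ν α β γ θ₀ x X e (n + 1)
      = ∫ ω, ∫ z, H (A ω, z) ∂(μ.prod ν) ∂P := by
    rw [mse, integral_congr_ae (.of_forall herr),
      ← integral_map (φ := fun ω => (A ω, Z ω)) (hAm.prodMk hZm).aemeasurable
        (f := H) hHm.aestronglyMeasurable, hmap, integral_prod _ hHint,
      integral_map hAm.aemeasurable hHint.integral_prod_left.aestronglyMeasurable]
  have hinner : Integrable (fun ω => ∫ z, H (A ω, z) ∂(μ.prod ν)) P :=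
    (integrable_map_measure hHint.integral_prod_left.aestronglyMeasurable
      hAm.aemeasurable).1 hHint.integral_prod_left
  have hpm : Measurable p := by
    rw [hp]
    exact (measurable_mass x).comp (measurable_kthDist x k n fun i _ => h.measurable_input i)
  have hp0 : ∀ ω, 0 ≤ p ω := fun ω => by rw [hp]; exact measureReal_nonneg
  have hp1 : ∀ ω, p ω ≤ 1 := fun ω => by rw [hp]; exact measureReal_le_one
  have hd0 : 0 ≤ 1 + 1 / (d : ℝ) := by positivity
  have hip : Integrable p P := Integrable.of_bound (C := 1) hpm.aestronglyMeasurable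
    (.of_forall fun ω => by rw [Real.norm_eq_abs, abs_of_nonneg (hp0 ω)]; exact hp1 ω)
  have hiq : Integrable (fun ω => p ω ^ (1 + 1 / (d : ℝ))) P :=
    Integrable.of_bound (C := 1) (hpm.pow_const _).aestronglyMeasurable (.of_forall fun ω => by
      rw [Real.norm_eq_abs, abs_of_nonneg (Real.rpow_nonneg (hp0 ω) _)]
      exact Real.rpow_le_one (hp0 ω) (hp1 ω) hd0)
  have hSm : MeasurableSet {ω | p ω < s} := measurableSet_lt hpm measurable_const
  have hiS : Integrable ({ω | p ω < s}.indicator fun _ => (1 : ℝ)) P :=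
    (integrable_const _).indicator hSm
  have hiD := integrable_error_sq hg h (hK₀ n)
  have hi1 := hiD.const_mul (1 - 2 * w * c * s)
  have hi2 := hiS.const_mul (2 * w * c * s * K₀ ^ 2)
  have hi3 := hiq.const_mul (2 * w * K₀ * K)
  have hi12 : Integrable (fun ω => (1 - 2 * w * c * s) * error g ν α β γ θ₀ x X e n ω ^ 2
      + 2 * w * c * s * K₀ ^ 2 * {ω | p ω < s}.indicator (fun _ => (1 : ℝ)) ω) P := hi1.add hi2
  have hi123 : Integrable (fun ω => (1 - 2 * w * c * s) * error g ν α β γ θ₀ x X e n ω ^ 2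
      + 2 * w * c * s * K₀ ^ 2 * {ω | p ω < s}.indicator (fun _ => (1 : ℝ)) ω
      + 2 * w * K₀ * K * p ω ^ (1 + 1 / (d : ℝ))) P := hi12.add hi3
  have hi4 := hip.const_mul (w ^ 2)
  have hbound : ∀ᵐ ω ∂P, ∫ z, H (A ω, z) ∂(μ.prod ν) ≤
      (1 - 2 * w * c * s) * error g ν α β γ θ₀ x X e n ω ^ 2
      + 2 * w * c * s * K₀ ^ 2 * {ω | p ω < s}.indicator (fun _ => (1 : ℝ)) ω
      + 2 * w * K₀ * K * p ω ^ (1 + 1 / (d : ℝ)) + w ^ 2 * p ω := by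
    filter_upwards [hK₀ n] with ω hω
    have hω' : |(A ω).1 - q| ≤ K₀ := hω
    have h1 := integral_step_sq_le hg hα hα' (A ω).2 hw0 hω' (hc _ hω') (hK (A ω).2 (A ω).1)
    have h2 : μ.real (Metric.closedEBall x (A ω).2) = p ω := by rw [hp]
    rw [h2] at h1
    refine h1.trans ?_
    rw [herr0]
    have hD : ((A ω).1 - q) ^ 2 ≤ K₀ ^ 2 := sq_le_sq' (abs_le.1 hω').1 (abs_le.1 hω').2
    have hD0 : 0 ≤ ((A ω).1 - q) ^ 2 := sq_nonneg _
    have hwc : 0 ≤ 2 * w * c := by positivity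
    -- The random mass is traded for the deterministic threshold `s`; where `p < s` the loss is at
    -- most `s * K₀ ^ 2`.
    have h3 : ((A ω).1 - q) ^ 2 * s - s * K₀ ^ 2 * {ω | p ω < s}.indicator (fun _ => (1 : ℝ)) ω
        ≤ ((A ω).1 - q) ^ 2 * p ω := by
      by_cases hps : p ω < s
      · rw [Set.indicator_of_mem (show ω ∈ {ω | p ω < s} from hps)]
        nlinarith [hp0 ω, mul_nonneg hD0 (hp0 ω)]
      · rw [Set.indicator_of_notMem (show ω ∉ {ω | p ω < s} from hps)]
        nlinarith
    have h4 := mul_le_mul_of_nonneg_left h3 hwc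
    linarith
  rw [hmse]
  refine (integral_mono_ae hinner (hi123.add hi4) hbound).trans (le_of_eq ?_)
  rw [integral_add' hi123 hi4, integral_add hi12 hi3,
    integral_add hi1 hi2, integral_const_mul, integral_const_mul, integral_const_mul,
    integral_const_mul, integral_indicator_const _ hSm]
  simp [mse]

end Step

/-! ### Rates of convergence of recursive sequences -/

open Filter Topology in
-- In one step `y ^ (-η)` loses a relative amount of about `η / y`, negligible against `y ^ (-κ)` as
-- `κ < 1`; half of the contraction absorbs it.
lemma eventually_mul_rpow_sub_one_le {b κ η : ℝ} (hb : 0 < b) (hκ : κ < 1) (hη : 0 < η) :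
    ∀ᶠ y : ℝ in atTop, b * y ^ (-κ) ≤ 1 →
      (1 - b * y ^ (-κ)) * (y - 1) ^ (-η) ≤ (1 - b / 2 * y ^ (-κ)) * y ^ (-η) := by
  have h1 : Tendsto (fun y : ℝ => b * y ^ (1 - κ)) atTop atTop :=
    (tendsto_rpow_atTop (by linarith)).const_mul_atTop hb
  filter_upwards [h1.eventually_ge_atTop (4 * η), eventually_ge_atTop 2] with y hy hy2 hv
  have hy0 : 0 < y := by linarith
  have hy1 : 0 < y - 1 := by linarith
  set v := b * y ^ (-κ) with hvdef
  have hv0 : 0 < v := by positivity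
  have hvy : 4 * η / y ≤ v := by
    rw [div_le_iff₀ hy0, hvdef, mul_assoc]
    nth_rewrite 2 [← Real.rpow_one y]
    rw [← Real.rpow_add hy0, show -κ + 1 = 1 - κ by ring]
    exact hy
  have hw : 1 / (y - 1) * η ≤ v / 2 := by
    have : 1 / (y - 1) ≤ 2 / y := by
      rw [div_le_div_iff₀ hy1 hy0]; linarith
    calc 1 / (y - 1) * η ≤ 2 / y * η := by gcongr
      _ = (4 * η / y) / 2 := by ring
      _ ≤ v / 2 := by linarith
  have hpow : (y - 1) ^ (-η) ≤ y ^ (-η) * Real.exp (1 / (y - 1) * η) := by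
    have h2 : y / (y - 1) ≤ Real.exp (1 / (y - 1)) := by
      have := Real.add_one_le_exp (1 / (y - 1))
      have h3 : y / (y - 1) = 1 / (y - 1) + 1 := by field_simp; ring
      linarith
    have h3 := Real.rpow_le_rpow (by positivity) h2 hη.le
    rw [← Real.exp_mul, Real.div_rpow hy0.le hy1.le] at h3
    have h4 : (y - 1) ^ (-η) = y ^ (-η) * (y ^ η / (y - 1) ^ η) := by
      rw [Real.rpow_neg hy0.le, Real.rpow_neg hy1.le]
      have := Real.rpow_pos_of_pos hy0 η
      field_simp
    rw [h4]
    gcongr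
  have hexp : (1 - v / 2) * Real.exp (1 / (y - 1) * η) ≤ 1 := by
    have h2 : 1 - v / 2 ≤ Real.exp (-(v / 2)) := by linarith [Real.add_one_le_exp (-(v / 2))]
    calc _ ≤ Real.exp (-(v / 2)) * Real.exp (1 / (y - 1) * η) := by gcongr
      _ = Real.exp (1 / (y - 1) * η - v / 2) := by rw [← Real.exp_add]; ring_nf
      _ ≤ 1 := Real.exp_le_one_iff.2 (by linarith)
  have hyη : 0 < y ^ (-η) := Real.rpow_pos_of_pos hy0 _
  have hb2 : b / 2 * y ^ (-κ) = v / 2 := by rw [hvdef]; ring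
  rw [hb2]
  calc (1 - v) * (y - 1) ^ (-η)
      ≤ (1 - v) * (y ^ (-η) * Real.exp (1 / (y - 1) * η)) := by
        gcongr
    -- One factor of `(1 - v / 2) ^ 2 ≥ 1 - v` is kept, the other cancels the exponential.
    _ ≤ ((1 - v / 2) * (1 - v / 2)) * (y ^ (-η) * Real.exp (1 / (y - 1) * η)) := by
        gcongr; nlinarith
    _ = (1 - v / 2) * y ^ (-η) * ((1 - v / 2) * Real.exp (1 / (y - 1) * η)) := by ring
    _ ≤ (1 - v / 2) * y ^ (-η) * 1 := by
        gcongr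
        exact mul_nonneg (by linarith) hyη.le
    _ = _ := mul_one _

open Filter Topology in
/-- A bounded sequence with `a (n + 1) ≤ (1 - b (n + 1) ^ (-κ)) a n + C (n + 1) ^ (-κ - η)` decays
like `n ^ (-η)`, uniformly in the sequence. -/
lemma exists_le_rpow_of_recursion {b C κ η K : ℝ} (hb : 0 < b) (hκ0 : 0 < κ) (hκ : κ < 1)
    (hη : 0 < η) (n₀ : ℕ) :
    ∃ (N : ℕ) (C' : ℝ), 0 < C' ∧ ∀ a : ℕ → ℝ, (∀ n, a n ≤ K) →
      (∀ n : ℕ, n₀ ≤ n → a (n + 1) ≤ (1 - b * ((n : ℝ) + 1) ^ (-κ)) * a n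
        + C * ((n : ℝ) + 1) ^ (-κ - η)) →
      ∀ n, N ≤ n → a n ≤ C' * (n : ℝ) ^ (-η) := by
  have h1 : Tendsto (fun y : ℝ => b * y ^ (-κ)) atTop (𝓝 (b * 0)) :=
    (tendsto_rpow_neg_atTop hκ0).const_mul b
  rw [mul_zero] at h1
  have h2 : Tendsto (fun n : ℕ => (n : ℝ) + 1) atTop atTop :=
    tendsto_atTop_add_const_right _ _ tendsto_natCast_atTop_atTop
  obtain ⟨N, hN⟩ := eventually_atTop.1 (h2.eventually
    ((h1.eventually (ge_mem_nhds one_pos)).and (eventually_mul_rpow_sub_one_le hb hκ hη)))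
  set N' := max (max N n₀) 1 with hN'
  have hN1 : 1 ≤ N' := le_max_right _ _
  have hNpos : (0 : ℝ) < N' := by exact_mod_cast hN1
  -- The entries serve the forcing term (paid by the other half of the contraction), the start of
  -- the induction at `N'`, and positivity. None depends on the sequence.
  set C' := max (max (2 * C / b) (K * (N' : ℝ) ^ η)) 1 with hC'
  have hC'0 : 0 < C' := lt_of_lt_of_le one_pos (le_max_right _ _)
  refine ⟨N', C', hC'0, fun a hK ha n hn => ?_⟩
  induction n, hn using Nat.le_induction with
  | base =>
    refine (hK N').trans ?_
    rw [Real.rpow_neg hNpos.le, ← div_eq_mul_inv, le_div_iff₀ (Real.rpow_pos_of_pos hNpos _)]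
    exact (le_max_right _ _).trans (le_max_left _ _)
  | succ n hn ih =>
    have hnN : N ≤ n := (le_max_left _ _).trans ((le_max_left _ _).trans hn)
    have hnn : n₀ ≤ n := (le_max_right _ _).trans ((le_max_left _ _).trans hn)
    obtain ⟨h3, h4⟩ := hN n hnN
    have h4 := h4 h3
    rw [add_sub_cancel_right] at h4
    push_cast
    set y : ℝ := (n : ℝ) + 1
    have hy : 0 < y := by positivity
    have h5 : C ≤ C' * (b / 2) := by
      have : 2 * C / b ≤ C' := (le_max_left _ _).trans (le_max_left _ _)
      rw [div_le_iff₀ hb] at this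
      linarith
    have hyη : 0 < y ^ (-η) := Real.rpow_pos_of_pos hy _
    have hyκ : 0 < y ^ (-κ) := Real.rpow_pos_of_pos hy _
    have h6 : y ^ (-κ - η) = y ^ (-κ) * y ^ (-η) := by
      rw [← Real.rpow_add hy]; ring_nf
    calc a (n + 1) ≤ (1 - b * y ^ (-κ)) * a n + C * y ^ (-κ - η) := ha n hnn
      _ ≤ (1 - b * y ^ (-κ)) * (C' * (n : ℝ) ^ (-η)) + C' * (b / 2) * y ^ (-κ - η) := by
          gcongr
      _ = C' * ((1 - b * y ^ (-κ)) * (n : ℝ) ^ (-η)) + C' * (b / 2) * y ^ (-κ - η) := by ring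
      _ ≤ C' * ((1 - b / 2 * y ^ (-κ)) * y ^ (-η)) + C' * (b / 2) * y ^ (-κ - η) := by
          gcongr
      _ = C' * y ^ (-η) := by rw [h6]; ring

open Filter Topology in
-- As `β > 1 - ε`, the exponent is of order `-y ^ β`, which beats any multiple of `log y`.
lemma eventually_exp_le_rpow {β ε : ℝ} (hβ : 0 < β) (hε : 1 - β < ε) :
    ∀ᶠ y : ℝ in atTop, Real.exp (2 * y ^ (1 - ε) - (y ^ β - 1)) ≤ y ^ (-2 : ℝ) := by
  have h1 : Tendsto (fun y : ℝ => y ^ (-(β - (1 - ε)))) atTop (𝓝 0) :=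
    tendsto_rpow_neg_atTop (by linarith)
  have h2 := (isLittleO_log_rpow_atTop hβ).bound (show (0 : ℝ) < 1 / 8 by norm_num)
  have h3 := (tendsto_rpow_atTop hβ).eventually_ge_atTop 4
  filter_upwards [h1.eventually (ge_mem_nhds (show (0 : ℝ) < 1 / 8 by norm_num)), h2, h3,
    eventually_gt_atTop 0] with y h1 h2 h3 hy
  have h4 : y ^ (1 - ε) ≤ 1 / 8 * y ^ β := by
    have : y ^ (1 - ε) = y ^ (-(β - (1 - ε))) * y ^ β := by
      rw [← Real.rpow_add hy]; ring_nf
    rw [this]; gcongr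
  rw [Real.norm_eq_abs, Real.norm_eq_abs, abs_of_pos (Real.rpow_pos_of_pos hy β)] at h2
  have h5 := (le_abs_self _).trans h2
  rw [Real.rpow_def_of_pos hy (-2), Real.exp_le_exp]
  linarith

/-! ### The rate of the algorithm -/

section Rate

variable {μ : Measure (EuclideanSpace ℝ (Fin d))} [IsProbabilityMeasure μ]
  {Ω : Type*} [MeasurableSpace Ω] {P : Measure Ω} [IsProbabilityMeasure P]
  {X : ℕ → Ω → EuclideanSpace ℝ (Fin d)}

lemma sub_one_lt_numNeighbours (β : ℝ) (n : ℕ) :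
    ((n : ℝ) + 1) ^ β - 1 < numNeighbours β (n + 1) := by
  have := Nat.lt_floor_add_one (((n + 1 : ℕ) : ℝ) ^ β)
  rw [numNeighbours]
  push_cast at this ⊢
  linarith

lemma numNeighbours_le (β : ℝ) (n : ℕ) :
    (numNeighbours β (n + 1) : ℝ) ≤ ((n : ℝ) + 1) ^ β := by
  have := Nat.floor_le (a := ((n + 1 : ℕ) : ℝ) ^ β) (by positivity)
  rw [numNeighbours]
  push_cast at this ⊢
  exact this

lemma numNeighbours_pos {β : ℝ} (hβ : 0 ≤ β) (n : ℕ) : 0 < numNeighbours β (n + 1) := by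
  rw [numNeighbours, Nat.floor_pos]
  exact Real.one_le_rpow (by push_cast; linarith [n.cast_nonneg (α := ℝ)]) hβ

lemma integral_mass_rpow_le (hd : 0 < d) (hμ : μ ≪ volume) (hX : ∀ i, Measurable (X i))
    (hXμ : ∀ i, P.map (X i) = μ) (hind : iIndepFun X P) (x : EuclideanSpace ℝ (Fin d))
    {β q : ℝ} (hβ : 0 ≤ β) (hq : 0 ≤ q) {n : ℕ} (hn : 0 < n) :
    ∫ ω, μ.real (Metric.closedEBall x
      (kthDist (fun i => X i ω) x (numNeighbours β (n + 1)) n)) ^ q ∂P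
      ≤ 8 ^ q * ((n : ℝ) + 1) ^ ((β - 1) * q) + Real.exp (-(((n : ℝ) + 1) ^ β - 1)) := by
  set k := numNeighbours β (n + 1)
  have hk : (0 : ℝ) < k := by exact_mod_cast numNeighbours_pos hβ n
  have hn0 : (0 : ℝ) < n := by exact_mod_cast hn
  have hn1 : (1 : ℝ) ≤ n := by exact_mod_cast hn
  -- At the threshold `4k/n` the upper tail is at most `exp (-k)`, and `n ≥ (n + 1) / 2` turns `4`
  -- into `8`.
  have hs : (0 : ℝ) < 4 * k / n := by positivity
  refine (integral_rpow_le ((measurable_mass x).comp (measurable_kthDist x k n fun i _ => hX i))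
    (fun ω => measureReal_nonneg) (fun ω => measureReal_le_one) hq hs.le).trans ?_
  gcongr ?_ + ?_
  · rw [Real.rpow_mul (by positivity), ← Real.mul_rpow (by norm_num) (by positivity)]
    refine Real.rpow_le_rpow hs.le ?_ hq
    rw [Real.rpow_sub_one (by positivity), div_le_iff₀ hn0]
    have hkb := numNeighbours_le β n
    have hyβ : 0 < ((n : ℝ) + 1) ^ β := by positivity
    have h1 : (1 : ℝ) / 2 ≤ n / (n + 1) := by
      rw [div_le_div_iff₀ (by norm_num) (by positivity)]; linarith
    calc 4 * (k : ℝ) ≤ 8 * ((n : ℝ) + 1) ^ β * (1 / 2) := by linarith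
      _ ≤ 8 * ((n : ℝ) + 1) ^ β * (n / (n + 1)) := by gcongr
      _ = _ := by ring
  · refine (real_lt_mass_le hd hμ hX hXμ hind x k n hs).trans (Real.exp_le_exp.2 ?_)
    have h1 : (n : ℝ) * (4 * k / n) = 4 * k := by field_simp
    have h2 := sub_one_lt_numNeighbours β n
    rw [h1]
    linarith

lemma real_mass_lt_rpow_le (hd : 0 < d) (hμ : μ ≪ volume) (hX : ∀ i, Measurable (X i))
    (hXμ : ∀ i, P.map (X i) = μ) (hind : iIndepFun X P) (x : EuclideanSpace ℝ (Fin d))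
    {β ε : ℝ} (hε : 0 < ε) {n : ℕ} (hn : 0 < n) :
    P.real {ω | μ.real (Metric.closedEBall x
      (kthDist (fun i => X i ω) x (numNeighbours β (n + 1)) n)) < ((n : ℝ) + 1) ^ (-ε)}
      ≤ Real.exp (2 * ((n : ℝ) + 1) ^ (1 - ε) - (((n : ℝ) + 1) ^ β - 1)) := by
  have hn0 : (0 : ℝ) < n := by exact_mod_cast hn
  have hs0 : 0 < ((n : ℝ) + 1) ^ (-ε) := by positivity
  refine (real_mass_lt_le hd hμ hX hXμ hind x _ n hs0
    (Real.rpow_lt_one_of_one_lt_of_neg (by linarith) (by linarith))).trans (Real.exp_le_exp.2 ?_)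
  have h2 := sub_one_lt_numNeighbours β n
  have h3 : ((n : ℝ) + 1) ^ (1 - ε) = (n + 1) * ((n : ℝ) + 1) ^ (-ε) := by
    rw [sub_eq_add_neg, Real.rpow_add (by positivity), Real.rpow_one]
  rw [h3]
  nlinarith

/-- The estimate behind both regimes of the algorithm. -/
lemma exists_mse_le (hd : 0 < d)
    {g : EuclideanSpace ℝ (Fin d) → EuclideanSpace ℝ (Fin m) → ℝ}
    (hg : Measurable (Function.uncurry g))
    {ν : Measure (EuclideanSpace ℝ (Fin m))} [IsProbabilityMeasure ν]
    (hA1 : AssumptionA1 g μ ν) (hA2 : AssumptionA2 μ) (hA3 : AssumptionA3 g μ ν)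
    (hA4 : AssumptionA4 g μ ν) {x : EuclideanSpace ℝ (Fin d)} (hx : x ∈ μ.support)
    (hthick : ThickAt μ.support x) (hinterval : (codeLaw g ν x).support.OrdConnected)
    {α γ β ε η R : ℝ} (hα : 0 < α) (hα' : α < 1) (hγ : 0 < γ) (hβ : 0 < β) (hβ' : β < 1)
    (hε : 1 - β < ε) (hεγ : ε < 1 - γ) (hεη : ε < η) (hη : η ≤ (1 - β) * (1 + 1 / (d : ℝ)))
    (hη' : η ≤ γ + (1 - β)) :
    ∃ (N : ℕ) (C : ℝ), 0 < C ∧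
      ∀ (Ω : Type*) [MeasurableSpace Ω] (P : Measure Ω) [IsProbabilityMeasure P]
        (X : ℕ → Ω → EuclideanSpace ℝ (Fin d)) (e : ℕ → Ω → EuclideanSpace ℝ (Fin m)),
        IsSample P μ ν X e → ∀ θ₀ : ℝ, |θ₀| ≤ R → ∀ n : ℕ, N ≤ n →
          mse P g ν α β γ θ₀ x X e n ≤ C * (n : ℝ) ^ (-(η - ε)) := by
  have hμ : μ ≪ volume := by
    obtain ⟨C, hC, f, hf, hμf, hfC⟩ := hA2
    rw [hμf]; exact withDensity_absolutelyContinuous _ _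
  obtain ⟨L, U, hLU⟩ := hA3
  obtain ⟨Cg, hCg, hdens⟩ := hA4 x hx
  obtain ⟨K, hK0, hK⟩ := exists_bias_le hd hg hA1 hA2 hx hthick
  set K₀ := 1 + |L| + |U| + |R| + |quantile (codeLaw g ν x) α|
  have hK₀ : 0 < K₀ := by positivity
  have hgx : Measurable (g x) := hg.comp measurable_prodMk_left
  have : IsProbabilityMeasure (codeLaw g ν x) := Measure.isProbabilityMeasure_map hgx.aemeasurable
  obtain ⟨c, hc, hcq⟩ := exists_mul_sq_le_of_density hCg hdens hinterval hα hα' hK₀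
  have hε0 : 0 < ε := by linarith
  have hq0 : (0 : ℝ) ≤ 1 + 1 / d := by positivity
  have hd1 : 1 / (d : ℝ) ≤ 1 := by
    rw [div_le_one (by exact_mod_cast hd)]; exact_mod_cast hd
  -- The power `-2` bounding the exponential tails is therefore small enough.
  have hη2 : η ≤ 2 := by nlinarith
  have h2 : Filter.Tendsto (fun n : ℕ => (n : ℝ) + 1) Filter.atTop Filter.atTop :=
    Filter.tendsto_atTop_add_const_right _ _ tendsto_natCast_atTop_atTop
  obtain ⟨n₁, hn₁⟩ := Filter.eventually_atTop.1 (h2.eventually (eventually_exp_le_rpow hβ hε))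
  -- The three summands of the forcing constant stand for the small-mass event, the bias and the
  -- squared increment. The constants are fixed before any sample or starting value.
  obtain ⟨N, C, hC, hrec⟩ := exists_le_rpow_of_recursion (b := 2 * c)
    (C := 2 * c * K₀ ^ 2 + 2 * K₀ * K * (8 ^ (1 + 1 / (d : ℝ)) + 1) + 9)
    (κ := γ + ε) (η := η - ε) (K := K₀ ^ 2) (by linarith) (by linarith) (by linarith)
    (by linarith) (max n₁ 1)
  refine ⟨N, C, hC, fun Ω _ P _ X e hS θ₀ hθ₀ n hn => ?_⟩
  have hX := hS.measurable_input
  have hXμ := hS.map_input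
  have hXi := hS.iIndepFun_input
  have hbd := ae_all_iff.1 (ae_abs_error_le hg hS x R β hα.le hα'.le hγ.le hLU hθ₀)
  refine hrec (fun n => mse P g ν α β γ θ₀ x X e n) (fun n => ?_) (fun n hn => ?_) n hn
  · have h1 : ∫ _, K₀ ^ 2 ∂P = K₀ ^ 2 := by simp
    rw [← h1]
    refine integral_mono_ae (integrable_error_sq hg hS (hbd n)) (integrable_const _) ?_
    filter_upwards [hbd n] with ω hω
    exact sq_le_sq' (abs_le.1 hω).1 (abs_le.1 hω).2
  · have hn1 := hn₁ n ((le_max_left _ _).trans hn)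
    have hn0 : 0 < n := (le_max_right n₁ 1).trans hn
    have hstep := mse_succ_le hg hS hα.le hα'.le hc.le hbd hcq hK n
      (s := ((n : ℝ) + 1) ^ (-ε)) (by positivity) rfl
    have hI1 := integral_mass_rpow_le hd hμ hX hXμ hXi x hβ.le hq0 hn0
    have hI2 := integral_mass_rpow_le hd hμ hX hXμ hXi x hβ.le zero_le_one hn0
    have hI3 := real_mass_lt_rpow_le hd hμ hX hXμ hXi x (β := β) hε0 hn0
    simp only [Real.rpow_one, mul_one] at hI2
    set I1 := ∫ ω, μ.real (Metric.closedEBall x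
      (kthDist (fun i => X i ω) x (numNeighbours β (n + 1)) n)) ^ (1 + 1 / (d : ℝ)) ∂P
    set I2 := ∫ ω, μ.real (Metric.closedEBall x
      (kthDist (fun i => X i ω) x (numNeighbours β (n + 1)) n)) ∂P
    set I3 := P.real {ω | μ.real (Metric.closedEBall x
      (kthDist (fun i => X i ω) x (numNeighbours β (n + 1)) n)) < ((n : ℝ) + 1) ^ (-ε)}
    have hw : stepSize γ (n + 1) = ((n : ℝ) + 1) ^ (-γ) := by rw [stepSize]; push_cast; rfl
    rw [hw] at hstep
    set y : ℝ := (n : ℝ) + 1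
    have hy1 : 1 ≤ y := by linarith [n.cast_nonneg (α := ℝ)]
    have hy : 0 < y := by linarith
    have hexp : Real.exp (-(y ^ β - 1)) ≤ y ^ (-2 : ℝ) :=
      le_trans (Real.exp_le_exp.2 (by linarith [Real.rpow_nonneg hy.le (1 - ε)])) hn1
    have hle : ∀ a b : ℝ, a ≤ b → y ^ a ≤ y ^ b := fun a b h =>
      Real.rpow_le_rpow_of_exponent_le hy1 h
    have h2η : y ^ (-2 : ℝ) ≤ y ^ (-η) := hle _ _ (by linarith)
    have hI1' : I1 ≤ (8 ^ (1 + 1 / (d : ℝ)) + 1) * y ^ (-η) := by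
      have := hle ((β - 1) * (1 + 1 / (d : ℝ))) (-η) (by linarith)
      have h8 : (0 : ℝ) ≤ 8 ^ (1 + 1 / (d : ℝ)) := by positivity
      have h9 := mul_le_mul_of_nonneg_left this h8
      rw [add_mul, one_mul]
      exact hI1.trans (add_le_add h9 (hexp.trans h2η))
    have hyγ : 0 < y ^ (-γ) := Real.rpow_pos_of_pos hy _
    have hyγ1 : y ^ (-γ) ≤ 1 := Real.rpow_le_one_of_one_le_of_nonpos hy1 (by linarith)
    have hyε : 0 < y ^ (-ε) := Real.rpow_pos_of_pos hy _
    have hyε1 : y ^ (-ε) ≤ 1 := Real.rpow_le_one_of_one_le_of_nonpos hy1 (by linarith)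
    have hyη : 0 < y ^ (-η) := Real.rpow_pos_of_pos hy _
    -- One factor `y ^ (-γ)` is spent here, giving the variance exponent `γ + (1 - β) ≥ η`.
    have hI2' : y ^ (-γ) * I2 ≤ 9 * y ^ (-η) := by
      have h3 : y ^ (-γ) * y ^ (β - 1) ≤ y ^ (-η) := by
        rw [← Real.rpow_add hy]; exact hle _ _ (by linarith)
      have h4 : y ^ (-γ) * y ^ (-2 : ℝ) ≤ y ^ (-η) := by
        rw [← Real.rpow_add hy]; exact hle _ _ (by linarith)
      have h5 : I2 ≤ 8 * y ^ (β - 1) + y ^ (-2 : ℝ) := hI2.trans (by linarith)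
      calc y ^ (-γ) * I2 ≤ y ^ (-γ) * (8 * y ^ (β - 1) + y ^ (-2 : ℝ)) := by gcongr
        _ = 8 * (y ^ (-γ) * y ^ (β - 1)) + y ^ (-γ) * y ^ (-2 : ℝ) := by ring
        _ ≤ 9 * y ^ (-η) := by linarith
    have hI3' : I3 ≤ y ^ (-η) := hI3.trans (hn1.trans h2η)
    have hI30 : 0 ≤ I3 := measureReal_nonneg
    have hκη : y ^ (-(γ + ε) - (η - ε)) = y ^ (-γ) * y ^ (-η) := by
      rw [← Real.rpow_add hy]; ring_nf
    have hκ : y ^ (-(γ + ε)) = y ^ (-γ) * y ^ (-ε) := by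
      rw [← Real.rpow_add hy]; ring_nf
    rw [hκη, hκ]
    have t1 : 2 * y ^ (-γ) * c * y ^ (-ε) * K₀ ^ 2 * I3
        ≤ 2 * c * K₀ ^ 2 * (y ^ (-γ) * y ^ (-η)) := by
      calc _ = 2 * c * K₀ ^ 2 * (y ^ (-γ) * (y ^ (-ε) * I3)) := by ring
        _ ≤ 2 * c * K₀ ^ 2 * (y ^ (-γ) * (1 * y ^ (-η))) := by gcongr
        _ = _ := by ring
    have t2 : 2 * y ^ (-γ) * K₀ * K * I1
        ≤ 2 * K₀ * K * (8 ^ (1 + 1 / (d : ℝ)) + 1) * (y ^ (-γ) * y ^ (-η)) := by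
      calc _ = 2 * K₀ * K * (y ^ (-γ) * I1) := by ring
        _ ≤ 2 * K₀ * K * (y ^ (-γ) * ((8 ^ (1 + 1 / (d : ℝ)) + 1) * y ^ (-η))) := by gcongr
        _ = _ := by ring
    have t3 : (y ^ (-γ)) ^ 2 * I2 ≤ 9 * (y ^ (-γ) * y ^ (-η)) := by
      calc _ = y ^ (-γ) * (y ^ (-γ) * I2) := by ring
        _ ≤ y ^ (-γ) * (9 * y ^ (-η)) := by gcongr
        _ = _ := by ring
    have t0 : 1 - 2 * y ^ (-γ) * c * y ^ (-ε) = 1 - 2 * c * (y ^ (-γ) * y ^ (-ε)) := by ring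
    rw [t0] at hstep
    linarith

end Rate

end StochasticCode

end

/-! ### The two regimes -/

theorem corollary1 {d m : ℕ} (hd : 0 < d)
    (g : EuclideanSpace ℝ (Fin d) → EuclideanSpace ℝ (Fin m) → ℝ)
    (hg : Measurable (Function.uncurry g))
    (μ : Measure (EuclideanSpace ℝ (Fin d))) [IsProbabilityMeasure μ]
    (ν : Measure (EuclideanSpace ℝ (Fin m))) [IsProbabilityMeasure ν]
    (hA1 : StochasticCode.AssumptionA1 g μ ν)
    (hA2 : StochasticCode.AssumptionA2 μ)
    (hA3 : StochasticCode.AssumptionA3 g μ ν)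
    (hA4 : StochasticCode.AssumptionA4 g μ ν)
    (x : EuclideanSpace ℝ (Fin d)) (hx : x ∈ μ.support)
    (hthick : StochasticCode.ThickAt μ.support x)
    (hinterval : (StochasticCode.codeLaw g ν x).support.OrdConnected)
    (α : ℝ) (hα : 1 / 2 ≤ α) (hα' : α < 1)
    (γ β ε : ℝ) (hγ : 0 < γ) (hγβ : γ ≤ β) (hβ : β < 1) (hε : 1 - β < ε) (hε' : ε < 1)
    (R : ℝ) :
    ∃ (N₄ : ℕ) (C₇ C₈ : ℝ), 0 < C₇ ∧ 0 < C₈ ∧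
      ∀ (Ω : Type*) [MeasurableSpace Ω] (P : Measure Ω) [IsProbabilityMeasure P]
        (X : ℕ → Ω → EuclideanSpace ℝ (Fin d)) (e : ℕ → Ω → EuclideanSpace ℝ (Fin m)),
        StochasticCode.IsSample P μ ν X e →
        ∀ θ₀ : ℝ, |θ₀| ≤ R →
        ∀ n : ℕ, N₄ ≤ n →
          Integrable (fun ω => StochasticCode.error g ν α β γ θ₀ x X e n ω ^ 2) P ∧
          (1 - d * γ < β → ε < min (1 - γ) ((1 + 1 / (d : ℝ)) * (1 - β)) →
            StochasticCode.mse P g ν α β γ θ₀ x X e n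
              ≤ C₇ / (n : ℝ) ^ (-ε + (1 + 1 / (d : ℝ)) * (1 - β))) ∧
          (β ≤ 1 - d * γ → ε < min (1 - β + γ) (1 - γ) →
            StochasticCode.mse P g ν α β γ θ₀ x X e n
              ≤ C₈ / (n : ℝ) ^ (γ - β + 1 - ε)) := by
  have hα0 : 0 < α := by linarith
  have hβ0 : 0 < β := lt_of_lt_of_le hγ hγβ
  have hdR : (0 : ℝ) < d := by exact_mod_cast hd
  obtain ⟨L, U, hLU⟩ := hA3
  have h₇ : ∃ (N : ℕ) (C : ℝ), 0 < C ∧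
      ∀ (Ω : Type _) [MeasurableSpace Ω] (P : Measure Ω) [IsProbabilityMeasure P]
        (X : ℕ → Ω → EuclideanSpace ℝ (Fin d)) (e : ℕ → Ω → EuclideanSpace ℝ (Fin m)),
        StochasticCode.IsSample P μ ν X e → ∀ θ₀ : ℝ, |θ₀| ≤ R → ∀ n : ℕ, N ≤ n →
          1 - d * γ < β → ε < min (1 - γ) ((1 + 1 / (d : ℝ)) * (1 - β)) →
          StochasticCode.mse P g ν α β γ θ₀ x X e n
            ≤ C / (n : ℝ) ^ (-ε + (1 + 1 / (d : ℝ)) * (1 - β)) := by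
    by_cases h : 1 - d * γ < β ∧ ε < min (1 - γ) ((1 + 1 / (d : ℝ)) * (1 - β))
    · obtain ⟨h1, h2⟩ := h
      -- The regime says that `(1 - β)/d < γ`: the bias exponent is the smaller one and serves as
      -- `η`.
      rw [lt_min_iff] at h2
      have h3 : (1 - β) * (1 / (d : ℝ)) ≤ γ := by
        rw [mul_one_div, div_le_iff₀ hdR]; linarith
      obtain ⟨N, C, hC, hmain⟩ := StochasticCode.exists_mse_le hd hg hA1 hA2 ⟨L, U, hLU⟩ hA4 hx
        hthick hinterval (R := R) (η := (1 + 1 / (d : ℝ)) * (1 - β)) hα0 hα' hγ hβ0 hβ hε h2.1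
        h2.2 (by linarith) (by linarith)
      refine ⟨N, C, hC, fun Ω _ P _ X e hS θ₀ hθ₀ n hn _ _ => ?_⟩
      refine (hmain Ω P X e hS θ₀ hθ₀ n hn).trans (le_of_eq ?_)
      rw [Real.rpow_neg n.cast_nonneg, ← div_eq_mul_inv]
      congr 2; ring
    -- Outside the regime the claim is vacuous, so any constants do.
    · exact ⟨0, 1, one_pos, fun Ω _ P _ X e _ θ₀ _ n _ h1 h2 => absurd ⟨h1, h2⟩ h⟩
  have h₈ : ∃ (N : ℕ) (C : ℝ), 0 < C ∧
      ∀ (Ω : Type _) [MeasurableSpace Ω] (P : Measure Ω) [IsProbabilityMeasure P]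
        (X : ℕ → Ω → EuclideanSpace ℝ (Fin d)) (e : ℕ → Ω → EuclideanSpace ℝ (Fin m)),
        StochasticCode.IsSample P μ ν X e → ∀ θ₀ : ℝ, |θ₀| ≤ R → ∀ n : ℕ, N ≤ n →
          β ≤ 1 - d * γ → ε < min (1 - β + γ) (1 - γ) →
          StochasticCode.mse P g ν α β γ θ₀ x X e n ≤ C / (n : ℝ) ^ (γ - β + 1 - ε) := by
    by_cases h : β ≤ 1 - d * γ ∧ ε < min (1 - β + γ) (1 - γ)
    · obtain ⟨h1, h2⟩ := h
      -- Here `γ ≤ (1 - β)/d`, so the variance exponent serves as `η`.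
      rw [lt_min_iff] at h2
      have h3 : γ ≤ (1 - β) * (1 / (d : ℝ)) := by
        rw [mul_one_div, le_div_iff₀ hdR]; linarith
      obtain ⟨N, C, hC, hmain⟩ := StochasticCode.exists_mse_le hd hg hA1 hA2 ⟨L, U, hLU⟩ hA4 hx
        hthick hinterval (R := R) (η := γ + (1 - β)) hα0 hα' hγ hβ0 hβ hε h2.2
        (by linarith) (by linarith) le_rfl
      refine ⟨N, C, hC, fun Ω _ P _ X e hS θ₀ hθ₀ n hn _ _ => ?_⟩
      refine (hmain Ω P X e hS θ₀ hθ₀ n hn).trans (le_of_eq ?_)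
      rw [Real.rpow_neg n.cast_nonneg, ← div_eq_mul_inv]
      congr 2; ring
    · exact ⟨0, 1, one_pos, fun Ω _ P _ X e _ θ₀ _ n _ h1 h2 => absurd ⟨h1, h2⟩ h⟩
  obtain ⟨N₇, C₇, hC₇, h₇⟩ := h₇
  obtain ⟨N₈, C₈, hC₈, h₈⟩ := h₈
  refine ⟨max N₇ N₈, C₇, C₈, hC₇, hC₈, fun Ω _ P _ X e hS θ₀ hθ₀ n hn => ⟨?_,
    h₇ Ω P X e hS θ₀ hθ₀ n ((le_max_left _ _).trans hn),
    h₈ Ω P X e hS θ₀ hθ₀ n ((le_max_right _ _).trans hn)⟩⟩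
  have hbd := StochasticCode.ae_abs_error_le (γ := γ) hg hS x R β hα0.le hα'.le hγ.le hLU hθ₀
  exact StochasticCode.integrable_error_sq hg hS (ae_all_iff.1 hbd n)
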